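/- For a non-degenerate symmetric even matrix $T\in\mathbb Z^{m\times m}$ let $SO(T;\mathbb R)=\{U\in SL_m(\mathbb R): U^{tr}TU=T\}$, let $SO_0(T;\mathbb R)$ be the connected component of the identity, $SO_0(T;\mathbb Z)$ its subgroup of integral matrices, and let $$\mathcal D(T;\mathbb Z)=\{U\in SO_0(T;\mathbb Z): U\in I+\mathbb Z^{m\times m}T\}$$ be the discriminant kernel. For a positive integer $N$ put $$U(N)\oplus T=\begin{pmatrix}0&0&N\\0&T&0\\N&0&0\end{pmatrix},\qquad S_0=U(1)\oplus(-2),\qquad S_1=U(1)\oplus S_0 .$$ Let $\Gamma_2(\mathbb Z)=\{M\in\mathbb Z^{4\times4}: M^{tr}JM=J\}$, $J=\begin{pmatrix}0&I\\-I&0\end{pmatrix}$, be the Siegel modular group of degree $2$; write $M=\begin{pmatrix}A&B\\C&D\end{pmatrix}$ with $2\times2$ blocks $A=(a_{ij})$, $B=(b_{ij})$, $C=(c_{ij})$, $D=(d_{ij})$. Put $\begin{pmatrix}\alpha&\beta\\\gamma&\delta\end{pmatrix}^\sharp=\begin{pmatrix}\delta&-\beta\\-\gamma&\alpha\end{pmatrix}$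 and, for symmetric $2\times 2$ matrices, $\varphi\begin{pmatrix}\alpha&\beta\\\beta&\gamma\end{pmatrix}=(\alpha,\beta,\gamma)^{tr}$. For $M\in\Gamma_2(\mathbb Z)$ define $$\widetilde M=\begin{pmatrix}\alpha&a^{tr}S_0&\beta\\ b&K&c\\ \gamma&d^{tr}S_0&\delta\end{pmatrix}\in\mathbb Z^{5\times5},$$ where $\alpha=\det A$, $\beta=-\det B$, $\gamma=-\det C$, $\delta=\det D$, $a=-\varphi(A^\sharp B)$, $b=-\varphi(AC^\sharp)$, $c=\varphi(BD^\sharp)$, $d=\varphi(C^\sharp D)$, and $K$ is the matrix of the endomorphism $Z\mapsto AZD^\sharp+BZ^\sharp C^\sharp$ of the symmetric $2\times2$ matrices with respect to the basis $\begin{pmatrix}1&0\\0&0\end{pmatrix},\begin{pmatrix}0&1\\1&0\end{pmatrix},\begin{pmatrix}0&0\\0&1\end{pmatrix}$. **Theorem 1.** a) The map $\pm M\mapsto\widetilde M$ is a group isomorphism from $\Gamma_2(\mathbb Z)/\{\pm I\}$ onto $\mathcal D(S_1;\mathbb Z)$. b) For every integer $N\ge1$ the isomorphism in a) restricts to an isomorphism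 from $$\{M\in\Gamma_2(\mathbb Z): M\equiv\varepsilon I \bmod N \text{ for some } \varepsilon\in\mathbb Z \text{ with } \varepsilon^2\equiv1\bmod N\}/\{\pm I\}$$ onto $\mathcal D(NS_1;\mathbb Z)$. c) Let $n,N\ge1$ be integers with $n\mid N$, and let $F=\mathrm{diag}(1,1,1,n,N)$. Then $F\,\mathcal D(U(N)\oplus U(n)\oplus(-2);\mathbb Z)\,F^{-1}\subseteq\mathcal D(S_1;\mathbb Z)$, and the isomorphism in a) restricts to an isomorphism onto $F\,\mathcal D(U(N)\oplus U(n)\oplus(-2);\mathbb Z)\,F^{-1}$ from $G/\{\pm I\}$, where $G$ is the subgroup of all $M\in\Gamma_2(\mathbb Z)$ with - $a_{11}\equiv a_{22}\equiv d_{11}\equiv d_{22}\equiv\varepsilon\bmod n$ for some $\varepsilon\in\mathbb Z$ with $\varepsilon^2\equiv1\bmod n$, - $\det A\equiv\det D\equiv1\bmod N$, - $a_{21}\equiv b_{22}\equiv d_{12}\equiv0\bmod n$, - $c_{11}\equiv0\bmod Nn$ and $c_{12}\equiv c_{21}\equiv c_{22}\equiv0\bmod N$. -/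

import Mathlib

open Matrix

namespace SiegelOrth

/-! ### Discriminant kernels of integral quadratic forms -/

/-- The special orthogonal group `SO(T; ℝ) = {U ∈ SL_m(ℝ) ; Uᵗ T U = T}`. -/
def SO {m : ℕ} (T : Matrix (Fin m) (Fin m) ℝ) : Subgroup (SpecialLinearGroup (Fin m) ℝ) where
  carrier := {U | (U : Matrix (Fin m) (Fin m) ℝ)ᵀ * T * (U : Matrix (Fin m) (Fin m) ℝ) = T}
  one_mem' := by simp
  mul_mem' := by
    intro U V hU hV
    simp only [Set.mem_ofPred_eq] at *
    calc ((U * V : SpecialLinearGroup (Fin m) ℝ) : Matrix (Fin m) (Fin m) ℝ)ᵀ * T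
          * ((U * V : SpecialLinearGroup (Fin m) ℝ) : Matrix (Fin m) (Fin m) ℝ)
        = (V : Matrix (Fin m) (Fin m) ℝ)ᵀ
          * ((U : Matrix (Fin m) (Fin m) ℝ)ᵀ * T * (U : Matrix (Fin m) (Fin m) ℝ))
          * (V : Matrix (Fin m) (Fin m) ℝ) := by
            simp [Matrix.mul_assoc]
      _ = T := by rw [hU, hV]
  inv_mem' := by
    intro U hU
    simp only [Set.mem_ofPred_eq] at *
    have h1 : (U : Matrix (Fin m) (Fin m) ℝ)
        * ((U⁻¹ : SpecialLinearGroup (Fin m) ℝ) : Matrix (Fin m) (Fin m) ℝ) = 1 :=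
      congrArg Subtype.val (mul_inv_cancel U)
    generalize ((U⁻¹ : SpecialLinearGroup (Fin m) ℝ) : Matrix (Fin m) (Fin m) ℝ) = V at h1 ⊢
    have h2 : Vᵀ * (U : Matrix (Fin m) (Fin m) ℝ)ᵀ = 1 := by
      rw [← transpose_mul, h1, transpose_one]
    calc Vᵀ * T * V = Vᵀ * ((U : Matrix (Fin m) (Fin m) ℝ)ᵀ * T
          * (U : Matrix (Fin m) (Fin m) ℝ)) * V := by rw [hU]
      _ = (Vᵀ * (U : Matrix (Fin m) (Fin m) ℝ)ᵀ) * T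
          * ((U : Matrix (Fin m) (Fin m) ℝ) * V) := by simp only [Matrix.mul_assoc]
      _ = T := by rw [h1, h2, Matrix.one_mul, Matrix.mul_one]

/-- `SO₀(T; ℝ)`: the connected component of the identity of `SO(T; ℝ)`. -/
def SO₀ {m : ℕ} (T : Matrix (Fin m) (Fin m) ℝ) : Subgroup (SpecialLinearGroup (Fin m) ℝ) :=
  (Subgroup.connectedComponentOfOne (SO T)).map (SO T).subtype

/-- `SO₀(T; ℤ)`: the integral matrices in `SO₀(T; ℝ)`. -/
def SO₀Int {m : ℕ} (T : Matrix (Fin m) (Fin m) ℤ) : Subgroup (SpecialLinearGroup (Fin m) ℤ) :=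
  (SO₀ (T.map (Int.cast : ℤ → ℝ))).comap (SpecialLinearGroup.map (Int.castRingHom ℝ))

/-- The discriminant kernel `𝒟(T; ℤ) = {U ∈ SO₀(T; ℤ) ; U ∈ I + ℤ^{m×m} T}`. -/
def discKernel {m : ℕ} (T : Matrix (Fin m) (Fin m) ℤ) :
    Subgroup (SpecialLinearGroup (Fin m) ℤ) where
  carrier := {U | U ∈ SO₀Int T ∧
    ∃ X : Matrix (Fin m) (Fin m) ℤ, (U : Matrix (Fin m) (Fin m) ℤ) = 1 + X * T}
  one_mem' := ⟨one_mem _, 0, by simp⟩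
  mul_mem' := by
    rintro U V ⟨hU, X, hX⟩ ⟨hV, Y, hY⟩
    refine ⟨mul_mem hU hV, X + Y + X * T * Y, ?_⟩
    have hUV : ((U * V : SpecialLinearGroup (Fin m) ℤ) : Matrix (Fin m) (Fin m) ℤ)
        = (U : Matrix (Fin m) (Fin m) ℤ) * (V : Matrix (Fin m) (Fin m) ℤ) := rfl
    rw [hUV, hX, hY]
    noncomm_ring
  inv_mem' := by
    rintro U ⟨hU, X, hX⟩
    refine ⟨inv_mem hU,
      -((U⁻¹ : SpecialLinearGroup (Fin m) ℤ) : Matrix (Fin m) (Fin m) ℤ) * X, ?_⟩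
    have h1 : ((U⁻¹ : SpecialLinearGroup (Fin m) ℤ) : Matrix (Fin m) (Fin m) ℤ)
        * (U : Matrix (Fin m) (Fin m) ℤ) = 1 :=
      congrArg Subtype.val (inv_mul_cancel U)
    generalize ((U⁻¹ : SpecialLinearGroup (Fin m) ℤ) : Matrix (Fin m) (Fin m) ℤ) = V at h1 ⊢
    rw [hX, Matrix.mul_add, Matrix.mul_one] at h1
    rw [Matrix.neg_mul, Matrix.neg_mul, Matrix.mul_assoc, ← h1]
    abel

/-! ### The quadratic forms -/

/-- The square matrix of size `m + 2` with the block rows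
`(α, r, β)`, `(b, K, c)`, `(γ, s, δ)`; here `r`, `s` are rows and `b`, `c` are columns. -/
def bordered {m : ℕ} (α : ℤ) (r : Fin m → ℤ) (β : ℤ)
    (b : Fin m → ℤ) (K : Matrix (Fin m) (Fin m) ℤ) (c : Fin m → ℤ)
    (γ : ℤ) (s : Fin m → ℤ) (δ : ℤ) : Matrix (Fin (m + 2)) (Fin (m + 2)) ℤ :=
  Matrix.of (Fin.cons (Fin.cons α (Fin.snoc r β : Fin (m + 1) → ℤ) : Fin (m + 2) → ℤ)
    (Fin.snoc (fun i => (Fin.cons (b i) (Fin.snoc (K i) (c i) : Fin (m + 1) → ℤ) : Fin (m + 2) → ℤ))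
      (Fin.cons γ (Fin.snoc s δ : Fin (m + 1) → ℤ) : Fin (m + 2) → ℤ) :
        Fin (m + 1) → Fin (m + 2) → ℤ))

/-- `U(N) ⊕ T`: the matrix with the block rows `(0, 0, N)`, `(0, T, 0)`, `(N, 0, 0)`. -/
def hypSum {m : ℕ} (N : ℕ) (T : Matrix (Fin m) (Fin m) ℤ) :
    Matrix (Fin (m + 2)) (Fin (m + 2)) ℤ :=
  bordered 0 0 N 0 T 0 N 0 0

/-- `U(N) ⊕ U(n) ⊕ (-2)`. -/
def formT (N n : ℕ) : Matrix (Fin 5) (Fin 5) ℤ := hypSum N (hypSum n !![-2])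

/-- `S₀ = U(1) ⊕ (-2)`. -/
def S₀ : Matrix (Fin 3) (Fin 3) ℤ := hypSum 1 !![-2]

/-- `S₁ = U(1) ⊕ S₀ = U(1) ⊕ U(1) ⊕ (-2)`. -/
def S₁ : Matrix (Fin 5) (Fin 5) ℤ := hypSum 1 S₀

/-! ### The Siegel modular group -/

/-- The Siegel modular group `Γ₂(ℤ)` of degree `2`. (Mathlib's skew form is the negative of
`(0, I; -I, 0)`, and its membership condition `M J Mᵗ = J` is equivalent to `Mᵗ J M = J`; see
`mem_Γ₂_iff`.) -/
abbrev Γ₂ : Type := Matrix.symplecticGroup (Fin 2) ℤ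

/-- The defining condition `Mᵗ J M = J`, `J = (0, I; -I, 0)`. -/
theorem mem_Γ₂_iff (M : Matrix (Fin 2 ⊕ Fin 2) (Fin 2 ⊕ Fin 2) ℤ) :
    M ∈ Matrix.symplecticGroup (Fin 2) ℤ ↔
      Mᵀ * fromBlocks 0 1 (-1) 0 * M = fromBlocks 0 1 (-1) 0 := by
  have h : (fromBlocks 0 1 (-1) 0 : Matrix (Fin 2 ⊕ Fin 2) (Fin 2 ⊕ Fin 2) ℤ)
      = -Matrix.J (Fin 2) ℤ := by
    simp [Matrix.J, fromBlocks_neg]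
  rw [SymplecticGroup.mem_iff', h, Matrix.mul_neg, Matrix.neg_mul, neg_inj]

namespace Γ₂

/-- The upper left block of `M`. -/
def A (M : Γ₂) : Matrix (Fin 2) (Fin 2) ℤ := (M : Matrix (Fin 2 ⊕ Fin 2) (Fin 2 ⊕ Fin 2) ℤ).toBlocks₁₁
/-- The upper right block of `M`. -/
def B (M : Γ₂) : Matrix (Fin 2) (Fin 2) ℤ := (M : Matrix (Fin 2 ⊕ Fin 2) (Fin 2 ⊕ Fin 2) ℤ).toBlocks₁₂
/-- The lower left block of `M`. -/
def C (M : Γ₂) : Matrix (Fin 2) (Fin 2) ℤ := (M : Matrix (Fin 2 ⊕ Fin 2) (Fin 2 ⊕ Fin 2) ℤ).toBlocks₂₁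
/-- The lower right block of `M`. -/
def D (M : Γ₂) : Matrix (Fin 2) (Fin 2) ℤ := (M : Matrix (Fin 2 ⊕ Fin 2) (Fin 2 ⊕ Fin 2) ℤ).toBlocks₂₂

theorem eq_fromBlocks (M : Γ₂) :
    (M : Matrix (Fin 2 ⊕ Fin 2) (Fin 2 ⊕ Fin 2) ℤ) = fromBlocks M.A M.B M.C M.D :=
  (fromBlocks_toBlocks _).symm

theorem mul_blocks (M N : Γ₂) :
    (M * N).A = M.A * N.A + M.B * N.C ∧ (M * N).B = M.A * N.B + M.B * N.D ∧
    (M * N).C = M.C * N.A + M.D * N.C ∧ (M * N).D = M.C * N.B + M.D * N.D := by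
  have h := (M * N).eq_fromBlocks
  rw [Submonoid.coe_mul, M.eq_fromBlocks, N.eq_fromBlocks, fromBlocks_multiply,
    fromBlocks_inj] at h
  exact ⟨h.1.symm, h.2.1.symm, h.2.2.1.symm, h.2.2.2.symm⟩

theorem inv_blocks (M : Γ₂) :
    (M⁻¹).A = M.Dᵀ ∧ (M⁻¹).B = -M.Bᵀ ∧ (M⁻¹).C = -M.Cᵀ ∧ (M⁻¹).D = M.Aᵀ := by
  have h := (M⁻¹).eq_fromBlocks
  rw [SymplecticGroup.coe_inv, M.eq_fromBlocks, Matrix.J, fromBlocks_transpose, fromBlocks_neg,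
    fromBlocks_multiply, fromBlocks_multiply, fromBlocks_inj] at h
  simp only [neg_zero, Matrix.zero_mul, Matrix.mul_zero, zero_add, add_zero, neg_neg, Matrix.one_mul,
    Matrix.mul_one, Matrix.neg_mul, Matrix.mul_neg] at h
  exact ⟨h.1.symm, h.2.1.symm, h.2.2.1.symm, h.2.2.2.symm⟩

theorem one_blocks : (1 : Γ₂).A = 1 ∧ (1 : Γ₂).B = 0 ∧ (1 : Γ₂).C = 0 ∧ (1 : Γ₂).D = 1 := by
  have h := (1 : Γ₂).eq_fromBlocks
  rw [Submonoid.coe_one, ← fromBlocks_one, fromBlocks_inj] at h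
  exact ⟨h.1.symm, h.2.1.symm, h.2.2.1.symm, h.2.2.2.symm⟩

end Γ₂

/-- The subgroup `{±I}` of `Γ₂(ℤ)`. -/
def pmOne : Subgroup Γ₂ where
  carrier := {M | (M : Matrix (Fin 2 ⊕ Fin 2) (Fin 2 ⊕ Fin 2) ℤ) = 1 ∨
    (M : Matrix (Fin 2 ⊕ Fin 2) (Fin 2 ⊕ Fin 2) ℤ) = -1}
  one_mem' := Or.inl rfl
  mul_mem' := by
    rintro M N (hM | hM) (hN | hN) <;>
      simp only [Set.mem_ofPred_eq, Submonoid.coe_mul, hM, hN, Matrix.one_mul, Matrix.mul_one,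
        Matrix.neg_mul, Matrix.mul_neg, neg_neg, true_or, or_true]
  inv_mem' := by
    rintro M (hM | hM)
    · left; rw [SymplecticGroup.coe_inv', hM, inv_one]
    · right; rw [SymplecticGroup.coe_inv', hM]; exact Matrix.inv_eq_right_inv (by simp)

instance pmOne_normal : pmOne.Normal where
  conj_mem := by
    rintro M hM g
    have hc : g * M = M * g := by
      rcases hM with hM | hM <;> exact Subtype.ext (by simp [hM])
    rw [hc, mul_assoc, mul_inv_cancel, mul_one]
    exact hM

/-! ### The map `M ↦ M̃` -/

/-- The coordinates `φ(α, β; β, γ) = (α, β, γ)ᵗ` on the symmetric `2 × 2` matrices. It is applied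
to symmetric matrices only; see `adj_isSymm` and `endo_isSymm`. -/
def φ (Z : Matrix (Fin 2) (Fin 2) ℤ) : Fin 3 → ℤ := ![Z 0 0, Z 0 1, Z 1 1]

/-- The basis `(1, 0; 0, 0)`, `(0, 1; 1, 0)`, `(0, 0; 0, 1)` of the symmetric `2 × 2` matrices. -/
def symBasis : Fin 3 → Matrix (Fin 2) (Fin 2) ℤ :=
  ![!![1, 0; 0, 0], !![0, 1; 1, 0], !![0, 0; 0, 1]]

/-- The endomorphism `f_M : Z ↦ A Z D^♯ + B Z^♯ C^♯`. -/
def endo (M : Γ₂) (Z : Matrix (Fin 2) (Fin 2) ℤ) : Matrix (Fin 2) (Fin 2) ℤ :=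
  M.A * Z * M.D.adjugate + M.B * Z.adjugate * M.C.adjugate

/-- The matrix `K` of `f_M` with respect to `symBasis`: its columns are the coordinates of the
images of the basis vectors. -/
def matK (M : Γ₂) : Matrix (Fin 3) (Fin 3) ℤ :=
  Matrix.of fun i j => φ (endo M (symBasis j)) i

/-- The matrix `M̃` attached to `M`. -/
def tilde (M : Γ₂) : Matrix (Fin 5) (Fin 5) ℤ :=
  bordered M.A.det (-φ (M.A.adjugate * M.B) ᵥ* S₀) (-M.B.det)
    (-φ (M.A * M.C.adjugate)) (matK M) (φ (M.B * M.D.adjugate))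
    (-M.C.det) (φ (M.C.adjugate * M.D) ᵥ* S₀) M.D.det

theorem Γ₂.relations (M : Γ₂) :
    M.A * M.Bᵀ = M.B * M.Aᵀ ∧ M.C * M.Dᵀ = M.D * M.Cᵀ ∧
    M.Aᵀ * M.C = M.Cᵀ * M.A ∧ M.Bᵀ * M.D = M.Dᵀ * M.B ∧ M.Aᵀ * M.D - M.Cᵀ * M.B = 1 := by
  have h1 := M.2
  have h2 := M.2
  rw [SymplecticGroup.mem_iff, M.eq_fromBlocks, Matrix.J, fromBlocks_transpose,
    fromBlocks_multiply, fromBlocks_multiply, fromBlocks_inj] at h1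
  rw [SymplecticGroup.mem_iff', M.eq_fromBlocks, Matrix.J, fromBlocks_transpose,
    fromBlocks_multiply, fromBlocks_multiply, fromBlocks_inj] at h2
  simp only [Matrix.zero_mul, Matrix.mul_zero, zero_add, add_zero, Matrix.one_mul,
    Matrix.mul_one, Matrix.neg_mul, Matrix.mul_neg] at h1 h2
  obtain ⟨a1, a2, a3, a4⟩ := h1
  obtain ⟨b1, b2, b3, b4⟩ := h2
  refine ⟨?_, ?_, ?_, ?_, ?_⟩
  · rw [← sub_eq_zero, ← neg_eq_zero, ← a1]; abel
  · rw [← sub_eq_zero, ← neg_eq_zero, ← a4]; abel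
  · rw [← sub_eq_zero, ← neg_eq_zero, ← b1]; abel
  · rw [← sub_eq_zero, ← neg_eq_zero, ← b4]; abel
  · rw [← neg_inj, ← b2]; abel

/-- The matrices to which `φ` is applied in the border of `M̃` are symmetric. -/
theorem adj_isSymm (M : Γ₂) :
    (M.A.adjugate * M.B).IsSymm ∧ (M.A * M.C.adjugate).IsSymm ∧
    (M.B * M.D.adjugate).IsSymm ∧ (M.C.adjugate * M.D).IsSymm := by
  obtain ⟨h1, h2, h3, h4, -⟩ := M.relations
  have e1 := congrFun (congrFun h1 0) 1
  have e2 := congrFun (congrFun h2 0) 1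
  have e3 := congrFun (congrFun h3 0) 1
  have e4 := congrFun (congrFun h4 0) 1
  simp only [Matrix.mul_apply, Fin.sum_univ_two, Matrix.transpose_apply] at e1 e2 e3 e4
  refine ⟨?_, ?_, ?_, ?_⟩ <;> rw [Matrix.adjugate_fin_two] <;> refine Matrix.IsSymm.ext ?_ <;>
    intro i j <;> fin_cases i <;> fin_cases j <;>
    simp [Matrix.mul_apply, Fin.sum_univ_two] <;> linarith

/-- `f_M` maps symmetric matrices to symmetric matrices. -/
theorem endo_isSymm (M : Γ₂) {Z : Matrix (Fin 2) (Fin 2) ℤ} (hZ : Z.IsSymm) :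
    (endo M Z).IsSymm := by
  obtain ⟨-, -, -, -, h⟩ := M.relations
  have e00 := congrFun (congrFun h 0) 0
  have e01 := congrFun (congrFun h 0) 1
  have e10 := congrFun (congrFun h 1) 0
  have e11 := congrFun (congrFun h 1) 1
  have hz : Z 1 0 = Z 0 1 := hZ.apply 0 1
  simp [Matrix.mul_apply, Fin.sum_univ_two] at e00 e01 e10 e11
  have key : endo M Z 1 0 = endo M Z 0 1 := by
    simp only [endo, Matrix.adjugate_fin_two, Matrix.add_apply, Matrix.mul_apply,
      Fin.sum_univ_two, hz]
    simp
    linear_combination (Z 0 1) * (e11 - e00) + (Z 0 0) * e01 - (Z 1 1) * e10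
  refine Matrix.IsSymm.ext ?_
  intro i j
  fin_cases i <;> fin_cases j <;> simp [key]

/-- `K` represents `f_M` in the coordinates `φ`. -/
theorem φ_endo (M : Γ₂) {Z : Matrix (Fin 2) (Fin 2) ℤ} (hZ : Z.IsSymm) :
    φ (endo M Z) = matK M *ᵥ φ Z := by
  have hz : Z 1 0 = Z 0 1 := hZ.apply 0 1
  funext i
  fin_cases i <;>
  · simp [φ, matK, endo, symBasis, Matrix.mulVec, dotProduct, Fin.sum_univ_three,
      Matrix.adjugate_fin_two, Matrix.mul_apply, Fin.sum_univ_two, hz]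
    ring

/-! ### The congruence subgroups -/

/-- The group `{M ∈ Γ₂(ℤ) ; M ≡ ε I mod N, ε ∈ ℤ, ε² ≡ 1 mod N}`. -/
def principal (N : ℕ) : Subgroup Γ₂ where
  carrier := {M | ∃ ε : ℤ, ε ^ 2 ≡ 1 [ZMOD N] ∧
    ∀ i j, (M : Matrix (Fin 2 ⊕ Fin 2) (Fin 2 ⊕ Fin 2) ℤ) i j
      ≡ (ε • (1 : Matrix (Fin 2 ⊕ Fin 2) (Fin 2 ⊕ Fin 2) ℤ)) i j [ZMOD N]}
  one_mem' := ⟨1, by simp, fun i j => by simp⟩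
  mul_mem' := by
    rintro M M' ⟨ε, hε, h⟩ ⟨δ, hδ, h'⟩
    refine ⟨ε * δ, by simpa [mul_pow] using hε.mul hδ, fun i j => ?_⟩
    have : (ε * δ) • (1 : Matrix (Fin 2 ⊕ Fin 2) (Fin 2 ⊕ Fin 2) ℤ) = (ε • 1) * (δ • 1) := by
      simp
    rw [this, Submonoid.coe_mul, Matrix.mul_apply, Matrix.mul_apply]
    simp only [← ZMod.intCast_eq_intCast_iff] at h h' ⊢
    push_cast
    exact Finset.sum_congr rfl fun k _ => by rw [h, h']
  inv_mem' := by
    rintro M ⟨ε, hε, h⟩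
    refine ⟨ε, hε, ?_⟩
    obtain ⟨i1, i2, i3, i4⟩ := M.inv_blocks
    have hM := M.eq_fromBlocks
    have hM' := (M⁻¹).eq_fromBlocks
    rw [hM] at h
    rw [hM', i1, i2, i3, i4]
    rintro (i | i) (j | j)
    · simpa [Matrix.one_apply, eq_comm] using h (.inr j) (.inr i)
    · simpa [Matrix.one_apply, eq_comm] using (h (.inl j) (.inr i)).neg
    · simpa [Matrix.one_apply, eq_comm] using (h (.inr j) (.inl i)).neg
    · simpa [Matrix.one_apply, eq_comm] using h (.inl j) (.inl i)

/-- The conditions on `M` that define the second congruence subgroup. -/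
def CongCond (n N : ℕ) (M : Γ₂) : Prop :=
  (∃ ε : ℤ, ε ^ 2 ≡ 1 [ZMOD n] ∧ M.A 0 0 ≡ ε [ZMOD n] ∧ M.A 1 1 ≡ ε [ZMOD n] ∧
    M.D 0 0 ≡ ε [ZMOD n] ∧ M.D 1 1 ≡ ε [ZMOD n]) ∧
  M.A.det ≡ 1 [ZMOD N] ∧ M.D.det ≡ 1 [ZMOD N] ∧
  M.A 1 0 ≡ 0 [ZMOD n] ∧ M.B 1 1 ≡ 0 [ZMOD n] ∧ M.D 0 1 ≡ 0 [ZMOD n] ∧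
  M.C 0 0 ≡ 0 [ZMOD (N * n : ℕ)] ∧
  M.C 0 1 ≡ 0 [ZMOD N] ∧ M.C 1 0 ≡ 0 [ZMOD N] ∧ M.C 1 1 ≡ 0 [ZMOD N]

/-- The congruence subgroup of all `M ∈ Γ₂(ℤ)` that satisfy `CongCond`, for `n ∣ N`. -/
def congSubgroup (n N : ℕ) (hnN : n ∣ N) : Subgroup Γ₂ where
  carrier := {M | CongCond n N M}
  one_mem' := by
    obtain ⟨h1, h2, h3, h4⟩ := Γ₂.one_blocks
    simp only [Set.mem_ofPred_eq, CongCond, h1, h2, h3, h4]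
    exact ⟨⟨1, by simp⟩, by simp⟩
  mul_mem' := by
    rintro M M' ⟨⟨ε, hε, a1, a2, a3, a4⟩, a5, a6, a7, a8, a9, a10, a11, a12, a13⟩
      ⟨⟨δ, hδ, b1, b2, b3, b4⟩, b5, b6, b7, b8, b9, b10, b11, b12, b13⟩
    obtain ⟨e1, e2, e3, e4⟩ := M.mul_blocks M'
    have toN : ∀ {x : ℤ}, x ≡ 0 [ZMOD (N * n : ℕ)] → x ≡ 0 [ZMOD N] := fun h =>
      h.of_dvd (by push_cast; exact dvd_mul_right _ _)
    have ton : ∀ {x : ℤ}, x ≡ 0 [ZMOD N] → x ≡ 0 [ZMOD n] := fun h =>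
      h.of_dvd (by exact_mod_cast hnN)
    have a14 := toN a10
    have b14 := toN b10
    have a15 := ton a14
    have b15 := ton b14
    have a16 := ton a11
    have b16 := ton b11
    have a17 := ton a12
    have b17 := ton b12
    have a18 := ton a13
    have b18 := ton b13
    have p1 : M.C 0 1 * M'.A 1 0 ≡ 0 [ZMOD (N * n : ℕ)] := by
      rw [Int.modEq_zero_iff_dvd] at *
      push_cast
      exact mul_dvd_mul a11 b7
    have p2 : M.D 0 1 * M'.C 1 0 ≡ 0 [ZMOD (N * n : ℕ)] := by
      rw [Int.modEq_zero_iff_dvd] at *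
      push_cast
      rw [mul_comm (N : ℤ)]
      exact mul_dvd_mul a9 b12
    simp only [Set.mem_ofPred_eq, CongCond, e1, e2, e3, e4, Matrix.det_fin_two, Matrix.add_apply,
      Matrix.mul_apply, Fin.sum_univ_two]
    rw [Matrix.det_fin_two] at a5 a6 b5 b6
    simp only [← ZMod.intCast_eq_intCast_iff] at *
    push_cast at *
    refine ⟨⟨ε * δ, ?_, ?_, ?_, ?_, ?_⟩, ?_, ?_, ?_, ?_, ?_, ?_, ?_, ?_, ?_⟩ <;> push_cast
    · rw [mul_pow, hε, hδ, one_mul]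
    · linear_combination M'.A 0 0 * a1 + ε * b1 + M.A 0 1 * b7 + M.B 0 0 * b15 + M.B 0 1 * b17
    · linear_combination M'.A 0 1 * a7 + M'.A 1 1 * a2 + ε * b2 + M.B 1 0 * b16 + M.B 1 1 * b18
    · linear_combination M'.D 0 0 * a3 + ε * b3 + M'.B 0 0 * a15 + M'.B 1 0 * a16 + M'.D 1 0 * a9
    · linear_combination M.D 1 0 * b9 + M'.D 1 1 * a4 + ε * b4 + M'.B 0 1 * a17 + M'.B 1 1 * a18
    · simp only [b14, b11, b12, b13, mul_zero, add_zero]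
      linear_combination (M'.A 0 0 * M'.A 1 1 - M'.A 0 1 * M'.A 1 0) * a5 + b5
    · simp only [a14, a11, a12, a13, zero_mul, zero_add]
      linear_combination (M'.D 0 0 * M'.D 1 1 - M'.D 0 1 * M'.D 1 0) * a6 + b6
    · linear_combination M'.A 0 0 * a7 + M.A 1 1 * b7 + M.B 1 0 * b15 + M.B 1 1 * b17
    · linear_combination M'.B 0 1 * a7 + M.A 1 1 * b8 + M.B 1 0 * b9 + M'.D 1 1 * a8
    · linear_combination M'.B 0 1 * a15 + M'.B 1 1 * a16 + M.D 0 0 * b9 + M'.D 1 1 * a9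
    · linear_combination M'.A 0 0 * a10 + p1 + M.D 0 0 * b10 + p2
    · simp only [a14, a11, b11, b13]; ring
    · simp only [a12, a13, b14, b12]; ring
    · simp only [a12, a13, b11, b13]; ring
  inv_mem' := by
    rintro M ⟨⟨ε, hε, a1, a2, a3, a4⟩, a5, a6, a7, a8, a9, a10, a11, a12, a13⟩
    obtain ⟨e1, e2, e3, e4⟩ := M.inv_blocks
    simp only [Set.mem_ofPred_eq, CongCond, e1, e2, e3, e4, Matrix.det_transpose,
      Matrix.neg_apply, Matrix.transpose_apply]
    refine ⟨⟨ε, hε, a3, a4, a1, a2⟩, a6, a5, a9, ?_, a7, ?_, ?_, ?_, ?_⟩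
    · simpa using a8.neg
    · simpa using a10.neg
    · simpa using a12.neg
    · simpa using a11.neg
    · simpa using a13.neg

/-- `F = diag(1, 1, 1, n, N)` as an invertible rational matrix. -/
noncomputable def matF (n N : ℕ) (hn : 0 < n) (hN : 0 < N) : GL (Fin 5) ℚ :=
  GeneralLinearGroup.mkOfDetNeZero (Matrix.diagonal ![1, 1, 1, (n : ℚ), (N : ℚ)]) (by
    rw [Matrix.det_diagonal]
    simp [Fin.prod_univ_five, hn.ne', hN.ne'])

/-- `F 𝒟(U(N) ⊕ U(n) ⊕ (-2); ℤ) F⁻¹` as a subgroup of `GL₅(ℚ)`. -/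
noncomputable def conjKernel (n N : ℕ) (hn : 0 < n) (hN : 0 < N) : Subgroup (GL (Fin 5) ℚ) :=
  ((discKernel (formT N n)).map (SpecialLinearGroup.mapGL ℚ)).map
    (MulAut.conj (matF n N hn hN)).toMonoidHom

end SiegelOrth

/-!
The matrix `M̃` describes the action `X ↦ M X Mᵗ` of the symplectic group on the alternating
`4 × 4` matrices `altMatrix x`, `x ∈ ℤ⁵` (`altMatrix_tilde_mulVec`). Hence `M ↦ M̃` is
multiplicative, and `M̃ ≡ I` means that `M` commutes modulo `N` with enough matrices to be scalar
(`scalar_of_tilde_modEq_one`); `N = 0` gives the kernel `{±I}`.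

The remaining point of part a) is that the image is exactly the discriminant kernel. A Euclidean
descent shows that the group generated by the matrices `(I, S; 0, I)`, `(I, 0; S, I)` and
`diag(V, V^{-t})` moves every primitive isotropic vector of `ℤ⁵` to the first basis vector
(`IsPrimitiveIsotropic.reducible`). This is used twice. Applied to the first column of `M̃` it shows
that these matrices generate `Γ₂(ℤ)` (`elementary_eq_top`); as each generator is a product of
unipotent elements, which lie on one-parameter subgroups, `M̃` is in the identity component
(`exists_mem_discKernel`). Applied to the first column of `U ∈ 𝒟(S₁; ℤ)` it reduces surjectivity to
matrices that fix a hyperbolic pair, and then, since primitive isotropic vectors of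
`U(1) ⊕ (-2)` are squares up to sign, to `diag(1, s, k, s, 1)` with signs `s`, `k`
(`tildeHom_surjective`). Here `det = 1` gives `k = 1`, and `s = -1` is excluded because an element
of the identity component preserves the orientation of maximal positive definite subspaces
(`det_positivePairing_pos`).

For parts b) and c), membership in the respective discriminant kernel, after conjugation by
`F = diag(1, 1, 1, n, N)` in part c), means that the entries of `U - I` satisfy divisibility
conditions (`mem_discKernel_smul_iff`, `mem_conjKernel_iff`), while rescaling the form or
conjugating by `F` does not change the identity component. The symplectic relations translate the
divisibility conditions on `M̃ - I` into the congruences for `M` (`mem_principal_iff`,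
`mem_congSubgroup_iff`); the extra factor `2` in the middle column is automatic
(`tilde_middle_column`).
-/

namespace SiegelOrth

/-! ### The action on alternating matrices -/

theorem S₀_eq : S₀ = !![0, 0, 1; 0, -2, 0; 1, 0, 0] := by
  decide

theorem S₁_eq : S₁ =
    !![0, 0, 0, 0, 1; 0, 0, 0, 1, 0; 0, 0, -2, 0, 0; 0, 1, 0, 0, 0; 1, 0, 0, 0, 0] := by
  decide

theorem bordered_three (α : ℤ) (r : Fin 3 → ℤ) (β : ℤ) (b : Fin 3 → ℤ)
    (K : Matrix (Fin 3) (Fin 3) ℤ) (c : Fin 3 → ℤ) (γ : ℤ) (s : Fin 3 → ℤ) (δ : ℤ) :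
    bordered α r β b K c γ s δ =
      !![α, r 0, r 1, r 2, β;
        b 0, K 0 0, K 0 1, K 0 2, c 0;
        b 1, K 1 0, K 1 1, K 1 2, c 1;
        b 2, K 2 0, K 2 1, K 2 2, c 2;
        γ, s 0, s 1, s 2, δ] := by
  ext i j
  fin_cases i <;> fin_cases j <;> rfl

theorem formT_eq (N n : ℕ) : formT N n =
    !![0, 0, 0, 0, (N : ℤ); 0, 0, 0, (n : ℤ), 0; 0, 0, -2, 0, 0; 0, (n : ℤ), 0, 0, 0;
      (N : ℤ), 0, 0, 0, 0] := by
  ext i j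
  fin_cases i <;> fin_cases j <;> rfl

/-- The entries of `M̃` as polynomials in the entries of `M`. -/
theorem tilde_eq (M : Γ₂) : tilde M =
    !![M.A 0 0 * M.A 1 1 - M.A 0 1 * M.A 1 0,
        -(M.A 0 0 * M.B 1 1 - M.A 1 0 * M.B 0 1), 2 * (M.A 1 1 * M.B 0 1 - M.A 0 1 * M.B 1 1),
        -(M.A 1 1 * M.B 0 0 - M.A 0 1 * M.B 1 0), -(M.B 0 0 * M.B 1 1 - M.B 0 1 * M.B 1 0);
      -(M.A 0 0 * M.C 1 1 - M.A 0 1 * M.C 1 0),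
        M.A 0 0 * M.D 1 1 - M.B 0 1 * M.C 1 0,
        M.A 0 1 * M.D 1 1 - M.A 0 0 * M.D 1 0 + (M.B 0 0 * M.C 1 0 - M.B 0 1 * M.C 1 1),
        -(M.A 0 1 * M.D 1 0) + M.B 0 0 * M.C 1 1, M.B 0 0 * M.D 1 1 - M.B 0 1 * M.D 1 0;
      -(M.A 0 1 * M.C 0 0 - M.A 0 0 * M.C 0 1),
        -(M.A 0 0 * M.D 0 1) + M.B 0 1 * M.C 0 0,
        M.A 0 0 * M.D 0 0 - M.A 0 1 * M.D 0 1 + (M.B 0 1 * M.C 0 1 - M.B 0 0 * M.C 0 0),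
        M.A 0 1 * M.D 0 0 - M.B 0 0 * M.C 0 1, M.B 0 1 * M.D 0 0 - M.B 0 0 * M.D 0 1;
      -(M.A 1 1 * M.C 0 0 - M.A 1 0 * M.C 0 1),
        -(M.A 1 0 * M.D 0 1) + M.B 1 1 * M.C 0 0,
        M.A 1 0 * M.D 0 0 - M.A 1 1 * M.D 0 1 + (M.B 1 1 * M.C 0 1 - M.B 1 0 * M.C 0 0),
        M.A 1 1 * M.D 0 0 - M.B 1 0 * M.C 0 1, M.B 1 1 * M.D 0 0 - M.B 1 0 * M.D 0 1;
      -(M.C 0 0 * M.C 1 1 - M.C 0 1 * M.C 1 0),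
        M.C 0 0 * M.D 1 1 - M.C 1 0 * M.D 0 1, -(2 * (M.C 1 1 * M.D 0 1 - M.C 0 1 * M.D 1 1)),
        M.C 1 1 * M.D 0 0 - M.C 0 1 * M.D 1 0, M.D 0 0 * M.D 1 1 - M.D 0 1 * M.D 1 0] := by
  rw [tilde, bordered_three, S₀_eq]
  have hs : ∀ (v : Fin 3 → ℤ), v ᵥ* !![0, 0, 1; 0, -2, 0; 1, 0, 0] = ![v 2, -2 * v 1, v 0] := by
    intro v
    ext i
    fin_cases i <;> simp [Matrix.vecMul, dotProduct, Fin.sum_univ_three, mul_comm]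
  simp only [hs, matK, endo, symBasis, φ, Matrix.adjugate_fin_two, Matrix.det_fin_two,
    Matrix.mul_apply, Fin.sum_univ_two, Matrix.of_apply, Matrix.add_apply, Pi.neg_apply,
    Matrix.cons_val, Matrix.cons_val_zero, Matrix.cons_val_one]
  refine congrArg _ ?_
  simp only [Matrix.vecCons_inj, and_true, true_and]
  constructorm* _ ∧ _ <;> ring

/-- The alternating `4 × 4` matrix `(-x₀ J₂, Z J₂; J₂ Z, x₄ J₂)` with `J₂ = (0, 1; -1, 0)` and
`Z = (x₁, x₂; x₂, x₃)`. They are the alternating matrices orthogonal to the symplectic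
form, an invariant lattice of rank five. -/
def altMatrix (x : Fin 5 → ℤ) : Matrix (Fin 2 ⊕ Fin 2) (Fin 2 ⊕ Fin 2) ℤ :=
  fromBlocks !![0, -x 0; x 0, 0] !![-x 2, x 1; -x 3, x 2] !![x 2, x 3; -x 1, -x 2]
    !![0, x 4; -x 4, 0]

theorem altMatrix_injective : Function.Injective altMatrix := by
  intro x y h
  rw [altMatrix, altMatrix, fromBlocks_inj] at h
  obtain ⟨h1, h2, -, h4⟩ := h
  have a0 := congrFun (congrFun h1 1) 0
  have a1 := congrFun (congrFun h2 0) 1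
  have a2 := congrFun (congrFun h2 1) 1
  have a3 := congrFun (congrFun h2 1) 0
  have a4 := congrFun (congrFun h4 0) 1
  ext i
  fin_cases i <;> simp_all

/-- `M̃` is the matrix of the action `X ↦ M X Mᵗ` on alternating matrices. -/
theorem altMatrix_tilde_mulVec (M : Γ₂) (x : Fin 5 → ℤ) :
    altMatrix (tilde M *ᵥ x) = (M : Matrix (Fin 2 ⊕ Fin 2) (Fin 2 ⊕ Fin 2) ℤ) * altMatrix x *
      (M : Matrix (Fin 2 ⊕ Fin 2) (Fin 2 ⊕ Fin 2) ℤ)ᵀ := by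
  obtain ⟨h1, h2, h3, h4, h5⟩ := M.relations
  have e1 := congrFun (congrFun h1 0) 1
  have e2 := congrFun (congrFun h2 0) 1
  have e3 := congrFun (congrFun h3 0) 1
  have e4 := congrFun (congrFun h4 0) 1
  have e5 := fun i j => congrFun (congrFun h5 i) j
  have e500 := e5 0 0
  have e501 := e5 0 1
  have e510 := e5 1 0
  have e511 := e5 1 1
  rw [tilde_eq, M.eq_fromBlocks, fromBlocks_transpose, altMatrix, altMatrix, fromBlocks_multiply,
    fromBlocks_multiply, fromBlocks_inj]
  simp only [Matrix.mul_apply, Fin.sum_univ_two, Matrix.transpose_apply, Matrix.sub_apply,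
    Matrix.one_apply, Fin.isValue, one_ne_zero, zero_ne_one, if_true, if_false]
    at e1 e2 e3 e4 e500 e501 e510 e511
  simp only [Matrix.ext_iff.symm, Fin.forall_fin_two, Matrix.mul_apply, Fin.sum_univ_two,
    Matrix.transpose_apply, Matrix.add_apply, Matrix.of_apply, Matrix.mulVec, dotProduct,
    Fin.sum_univ_five, Matrix.cons_val, Matrix.cons_val_zero, Matrix.cons_val_one]
  refine ⟨⟨⟨?_, ?_⟩, ⟨?_, ?_⟩⟩, ⟨⟨?_, ?_⟩, ⟨?_, ?_⟩⟩, ⟨⟨?_, ?_⟩, ⟨?_, ?_⟩⟩, ⟨⟨?_, ?_⟩, ⟨?_, ?_⟩⟩⟩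
  -- these entries need the symplectic relations, the others are polynomial identities
  case refine_2 => linear_combination x 2 * e1
  case refine_3 => linear_combination -x 2 * e1
  case refine_8 =>
    linear_combination x 0 * e3 - x 4 * e4 - x 1 * e501 + x 3 * e510 + x 2 * (e500 - e511)
  case refine_12 =>
    linear_combination -x 0 * e3 + x 4 * e4 + x 1 * e501 - x 3 * e510 - x 2 * (e500 - e511)
  case refine_14 => linear_combination x 2 * e2
  case refine_15 => linear_combination -x 2 * e2
  all_goals ring1

theorem tilde_mul (M M' : Γ₂) : tilde (M * M') = tilde M * tilde M' := by
  refine Matrix.ext_of_mulVec_single fun i => altMatrix_injective ?_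
  rw [← Matrix.mulVec_mulVec]
  simp only [altMatrix_tilde_mulVec, Submonoid.coe_mul, Matrix.transpose_mul, Matrix.mul_assoc]

theorem tilde_one : tilde 1 = 1 := by
  obtain ⟨h1, h2, h3, h4⟩ := Γ₂.one_blocks
  rw [tilde_eq, h1, h2, h3, h4]
  decide

theorem tilde_mul_mulVec (M M' : Γ₂) (x : Fin 5 → ℤ) :
    tilde (M * M') *ᵥ x = tilde M *ᵥ (tilde M' *ᵥ x) := by
  rw [tilde_mul, Matrix.mulVec_mulVec]

/-! ### Matrices that are scalar modulo `N` -/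

/-- If `M̃` is congruent to the identity, so that `M` commutes modulo `N` with the action on
alternating matrices, then `M` is congruent to a scalar. The value `N = 0` is allowed and
describes the kernel of `M ↦ M̃`. -/
theorem scalar_of_tilde_modEq_one {N : ℤ} {M : Γ₂} (h : ∀ i j, N ∣ (tilde M - 1) i j) :
    ∃ ε : ℤ, ε ^ 2 ≡ 1 [ZMOD N] ∧ ∀ i j, (M : Matrix (Fin 2 ⊕ Fin 2) (Fin 2 ⊕ Fin 2) ℤ) i j
      ≡ (ε • (1 : Matrix (Fin 2 ⊕ Fin 2) (Fin 2 ⊕ Fin 2) ℤ)) i j [ZMOD N] := by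
  have key : ∀ k : Fin 5, ∀ i j, N ∣ ((M : Matrix (Fin 2 ⊕ Fin 2) (Fin 2 ⊕ Fin 2) ℤ) *
      altMatrix (Pi.single k 1) -
      altMatrix (Pi.single k 1) * fromBlocks M.D (-M.C) (-M.B) M.A) i j := by
    intro k
    have hinv : (M : Matrix (Fin 2 ⊕ Fin 2) (Fin 2 ⊕ Fin 2) ℤ)ᵀ *
        fromBlocks M.D (-M.C) (-M.B) M.A = 1 := by
      have h1 : ((M⁻¹ * M : Γ₂) : Matrix (Fin 2 ⊕ Fin 2) (Fin 2 ⊕ Fin 2) ℤ) = 1 := by simp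
      obtain ⟨i1, i2, i3, i4⟩ := M.inv_blocks
      rw [Submonoid.coe_mul, (M⁻¹).eq_fromBlocks, i1, i2, i3, i4] at h1
      have h2 := congrArg Matrix.transpose h1
      rw [Matrix.transpose_mul, Matrix.transpose_one, fromBlocks_transpose] at h2
      simpa using h2
    have h1 := congrArg (· * fromBlocks M.D (-M.C) (-M.B) M.A)
      (altMatrix_tilde_mulVec M (Pi.single k 1))
    simp only [Matrix.mul_assoc, hinv, Matrix.mul_one] at h1
    rw [← h1, ← Matrix.sub_mul]
    choose w hw using fun i => h i k
    have h2 : altMatrix (tilde M *ᵥ Pi.single k 1) - altMatrix (Pi.single k 1) =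
        N • altMatrix w := by
      have h3 : tilde M *ᵥ Pi.single k 1 = Pi.single k 1 + N • w := by
        funext i
        have := hw i
        simp [Matrix.one_apply, Pi.single_apply] at this ⊢
        linarith
      rw [h3]
      simp only [altMatrix, sub_eq_add_neg, fromBlocks_neg, fromBlocks_add, fromBlocks_smul]
      congr 1 <;> ext i j <;> fin_cases i <;> fin_cases j <;> simp
    intro i j
    rw [h2, Matrix.smul_mul]
    exact ⟨_, rfl⟩
  have hdet := h 0 0
  have k0 := key 0
  have k1 := key 1
  have k3 := key 3
  have k4 := key 4
  clear key h
  rw [tilde_eq] at hdet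
  rw [M.eq_fromBlocks] at k0 k1 k3 k4
  simp only [altMatrix, fromBlocks_multiply, sub_eq_add_neg, fromBlocks_neg, Sum.forall,
    fromBlocks_apply₁₁, fromBlocks_apply₁₂, fromBlocks_apply₂₁, fromBlocks_apply₂₂,
    Fin.forall_fin_two, Matrix.add_apply, Matrix.neg_apply, Matrix.mul_apply, Fin.sum_univ_two]
    at k0 k1 k3 k4
  simp at k0 k1 k3 k4 hdet
  obtain ⟨⟨⟨⟨-, a1⟩, -, -⟩, ⟨a2, -⟩, -, -⟩, ⟨c01, c00⟩, c11, c10⟩ := k0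
  obtain ⟨⟨⟨-, a10, a3⟩, -, -⟩, ⟨d01, -⟩, -, -, -⟩ := k1
  obtain ⟨⟨⟨-, a01⟩, -, -, -⟩, ⟨⟨d10, -⟩, -, -⟩, -, -⟩ := k3
  obtain ⟨⟨⟨b01, b00⟩, b11, b10⟩, -, -, -⟩ := k4
  have e1 := dvd_add (dvd_add hdet (a3.mul_left (M.A 0 0))) (a01.mul_right (M.A 1 0))
  have e2 := dvd_add a3 a2
  rw [show M.A 0 0 * M.A 1 1 - M.A 0 1 * M.A 1 0 - 1 + M.A 0 0 * (M.A 0 0 + -M.A 1 1) +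
    M.A 0 1 * M.A 1 0 = M.A 0 0 ^ 2 - 1 by ring] at e1
  rw [show M.A 0 0 + -M.A 1 1 + (M.A 1 1 + -M.D 0 0) = M.A 0 0 - M.D 0 0 by ring] at e2
  refine ⟨M.A 0 0, (Int.modEq_iff_dvd.2 e1).symm, ?_⟩
  rw [M.eq_fromBlocks]
  simp only [Sum.forall, Fin.forall_fin_two, fromBlocks_apply₁₁, fromBlocks_apply₁₂,
    fromBlocks_apply₂₁, fromBlocks_apply₂₂, Matrix.smul_apply, Matrix.one_apply, Sum.inl.injEq,
    Sum.inr.injEq, reduceCtorEq, Fin.isValue, one_ne_zero, zero_ne_one, if_true, if_false,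
    smul_eq_mul, mul_one, mul_zero, Int.modEq_zero_iff_dvd]
  simp only [Int.modEq_iff_dvd, sub_self, dvd_zero, true_and]
  refine ⟨⟨⟨a01, b00, b01⟩, ⟨a10, ?_⟩, b10, b11⟩, ⟨⟨c00, c01⟩, e2, d01⟩, ⟨c10, c11⟩, d10, ?_⟩
  · simpa [sub_eq_add_neg, add_comm] using a3
  · simpa [sub_eq_add_neg, add_comm] using a1.neg_right

/-! ### Elementary symplectic matrices -/

/-- The symplectic matrix `(I, S; 0, I)` with `S = (p, q; q, r)`. -/
def transUp (p q r : ℤ) : Γ₂ :=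
  ⟨fromBlocks 1 !![p, q; q, r] 0 1, by
    rw [mem_Γ₂_iff, fromBlocks_transpose, fromBlocks_multiply, fromBlocks_multiply]
    congr 1 <;> ext i j <;> fin_cases i <;> fin_cases j <;> simp⟩

/-- The symplectic matrix `(I, 0; S, I)` with `S = (p, q; q, r)`. -/
def transLow (p q r : ℤ) : Γ₂ :=
  ⟨fromBlocks 1 0 !![p, q; q, r] 1, by
    rw [mem_Γ₂_iff, fromBlocks_transpose, fromBlocks_multiply, fromBlocks_multiply]
    congr 1 <;> ext i j <;> fin_cases i <;> fin_cases j <;> simp⟩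

/-- The embedding `V ↦ diag(V, V^{-t})` of `SL₂(ℤ)` into `Γ₂(ℤ)`. -/
def levi : SpecialLinearGroup (Fin 2) ℤ →* Γ₂ where
  toFun V := ⟨fromBlocks V 0 0 ((V⁻¹ : SpecialLinearGroup (Fin 2) ℤ) : Matrix _ _ ℤ)ᵀ, by
    have h : (V : Matrix (Fin 2) (Fin 2) ℤ) *
        ((V⁻¹ : SpecialLinearGroup (Fin 2) ℤ) : Matrix (Fin 2) (Fin 2) ℤ) = 1 :=
      congrArg Subtype.val (mul_inv_cancel V)
    have h' : ((V⁻¹ : SpecialLinearGroup (Fin 2) ℤ) : Matrix (Fin 2) (Fin 2) ℤ) *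
        (V : Matrix (Fin 2) (Fin 2) ℤ) = 1 :=
      congrArg Subtype.val (inv_mul_cancel V)
    generalize ((V⁻¹ : SpecialLinearGroup (Fin 2) ℤ) : Matrix (Fin 2) (Fin 2) ℤ) = W at h h' ⊢
    rw [mem_Γ₂_iff, fromBlocks_transpose, fromBlocks_multiply, fromBlocks_multiply]
    have h2 := congrArg Matrix.transpose h'
    rw [Matrix.transpose_mul, Matrix.transpose_one] at h2
    simp [h2, h']⟩
  map_one' := Subtype.ext (by simp)
  map_mul' V W := Subtype.ext (by simp [fromBlocks_multiply])

theorem levi_blocks (V : SpecialLinearGroup (Fin 2) ℤ) :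
    (levi V).A = V ∧ (levi V).B = 0 ∧ (levi V).C = 0 ∧
      (levi V).D = !![V 1 1, -V 1 0; -V 0 1, V 0 0] := by
  refine ⟨rfl, rfl, rfl, ?_⟩
  have h := Matrix.SpecialLinearGroup.coe_inv V
  rw [Matrix.adjugate_fin_two] at h
  refine (congrArg Matrix.transpose h).trans ?_
  ext i j
  fin_cases i <;> fin_cases j <;> rfl

theorem tilde_transUp (p q r : ℤ) : tilde (transUp p q r) =
    !![1, -r, 2 * q, -p, q ^ 2 - p * r; 0, 1, 0, 0, p; 0, 0, 1, 0, q; 0, 0, 0, 1, r;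
      0, 0, 0, 0, 1] := by
  have hA : (transUp p q r).A = 1 := rfl
  have hB : (transUp p q r).B = !![p, q; q, r] := rfl
  have hC : (transUp p q r).C = 0 := rfl
  have hD : (transUp p q r).D = 1 := rfl
  rw [tilde_eq, hA, hB, hC, hD]
  simp
  ring

theorem tilde_transLow (p q r : ℤ) : tilde (transLow p q r) =
    !![1, 0, 0, 0, 0; -r, 1, 0, 0, 0; q, 0, 1, 0, 0; -p, 0, 0, 1, 0;
      q ^ 2 - p * r, p, 2 * q, r, 1] := by
  have hA : (transLow p q r).A = 1 := rfl
  have hB : (transLow p q r).B = 0 := rfl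
  have hC : (transLow p q r).C = !![p, q; q, r] := rfl
  have hD : (transLow p q r).D = 1 := rfl
  rw [tilde_eq, hA, hB, hC, hD]
  simp
  ring

theorem tilde_levi (V : SpecialLinearGroup (Fin 2) ℤ) : tilde (levi V) =
    !![1, 0, 0, 0, 0;
      0, V 0 0 ^ 2, 2 * (V 0 0 * V 0 1), V 0 1 ^ 2, 0;
      0, V 0 0 * V 1 0, V 0 0 * V 1 1 + V 0 1 * V 1 0, V 0 1 * V 1 1, 0;
      0, V 1 0 ^ 2, 2 * (V 1 0 * V 1 1), V 1 1 ^ 2, 0;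
      0, 0, 0, 0, 1] := by
  obtain ⟨h1, h2, h3, h4⟩ := levi_blocks V
  have hV : V 0 0 * V 1 1 - V 0 1 * V 1 0 = 1 := by rw [← Matrix.det_fin_two]; exact V.2
  rw [tilde_eq, h1, h2, h3, h4]
  simp
  constructorm* _ ∧ _ <;> first | trivial | linear_combination hV | ring1

theorem tilde_transUp_mulVec (p q r : ℤ) (x : Fin 5 → ℤ) : tilde (transUp p q r) *ᵥ x =
    ![x 0 - r * x 1 + 2 * q * x 2 - p * x 3 + (q ^ 2 - p * r) * x 4, x 1 + p * x 4,
      x 2 + q * x 4, x 3 + r * x 4, x 4] := by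
  rw [tilde_transUp]
  ext i
  fin_cases i <;> simp [Matrix.mulVec, dotProduct, Fin.sum_univ_five] <;> ring

theorem tilde_transLow_mulVec (p q r : ℤ) (x : Fin 5 → ℤ) : tilde (transLow p q r) *ᵥ x =
    ![x 0, x 1 - r * x 0, x 2 + q * x 0, x 3 - p * x 0,
      x 4 + p * x 1 + 2 * q * x 2 + r * x 3 + (q ^ 2 - p * r) * x 0] := by
  rw [tilde_transLow]
  ext i
  fin_cases i <;> simp [Matrix.mulVec, dotProduct, Fin.sum_univ_five] <;> ring

/-- The subgroup of `Γ₂(ℤ)` generated by the elementary matrices (it is everything). -/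
def elementary : Subgroup Γ₂ :=
  Subgroup.closure ({M | ∃ p q r, M = transUp p q r} ∪ {M | ∃ p q r, M = transLow p q r} ∪
    Set.range levi)

theorem transUp_mem (p q r : ℤ) : transUp p q r ∈ elementary :=
  Subgroup.subset_closure (Or.inl (Or.inl ⟨p, q, r, rfl⟩))

theorem transLow_mem (p q r : ℤ) : transLow p q r ∈ elementary :=
  Subgroup.subset_closure (Or.inl (Or.inr ⟨p, q, r, rfl⟩))

theorem levi_mem (V : SpecialLinearGroup (Fin 2) ℤ) : levi V ∈ elementary :=
  Subgroup.subset_closure (Or.inr ⟨V, rfl⟩)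

/-- The embedding of the Weyl element `(0, 1; -1, 0)` of `SL₂` in the first coordinate. -/
def weyl₁ : Γ₂ := transUp 1 0 0 * transLow (-1) 0 0 * transUp 1 0 0

/-- The embedding of the Weyl element `(0, 1; -1, 0)` of `SL₂` in the second coordinate. -/
def weyl₂ : Γ₂ := transUp 0 0 1 * transLow 0 0 (-1) * transUp 0 0 1

theorem weyl₁_mem : weyl₁ ∈ elementary :=
  mul_mem (mul_mem (transUp_mem _ _ _) (transLow_mem _ _ _)) (transUp_mem _ _ _)

theorem weyl₂_mem : weyl₂ ∈ elementary :=
  mul_mem (mul_mem (transUp_mem _ _ _) (transLow_mem _ _ _)) (transUp_mem _ _ _)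

/-- `weyl₁` moves the coordinate `x₁` to the last place, up to sign. -/
theorem tilde_weyl₁_mulVec (x : Fin 5 → ℤ) :
    tilde weyl₁ *ᵥ x = ![-x 3, x 4, x 2, x 0, -x 1] := by
  simp [weyl₁, tilde_mul_mulVec, tilde_transUp_mulVec, tilde_transLow_mulVec]

/-- `weyl₂` moves the coordinate `x₃` to the last place, up to sign. -/
theorem tilde_weyl₂_mulVec (x : Fin 5 → ℤ) :
    tilde weyl₂ *ᵥ x = ![-x 1, x 0, x 2, x 4, -x 3] := by
  simp [weyl₂, tilde_mul_mulVec, tilde_transUp_mulVec, tilde_transLow_mulVec]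

/-! ### Primitive isotropic vectors -/

/-- A vector of `ℤ⁵` that is isotropic for `S₁` and primitive. -/
structure IsPrimitiveIsotropic (x : Fin 5 → ℤ) : Prop where
  isotropic : x 0 * x 4 + x 1 * x 3 = x 2 ^ 2
  primitive : ∃ y : Fin 5 → ℤ, y ⬝ᵥ x = 1

theorem exists_dotProduct_tilde_mulVec_eq_one (M : Γ₂) {x : Fin 5 → ℤ}
    (h : ∃ y : Fin 5 → ℤ, y ⬝ᵥ x = 1) : ∃ y : Fin 5 → ℤ, y ⬝ᵥ (tilde M *ᵥ x) = 1 := by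
  obtain ⟨y, hy⟩ := h
  refine ⟨y ᵥ* tilde M⁻¹, ?_⟩
  rw [← Matrix.dotProduct_mulVec, ← tilde_mul_mulVec, inv_mul_cancel, tilde_one, Matrix.one_mulVec,
    hy]

theorem IsPrimitiveIsotropic.transUp {x : Fin 5 → ℤ} (h : IsPrimitiveIsotropic x) (p q r : ℤ) :
    IsPrimitiveIsotropic (tilde (transUp p q r) *ᵥ x) where
  isotropic := by
    rw [tilde_transUp_mulVec]
    simp
    linear_combination h.isotropic
  primitive := exists_dotProduct_tilde_mulVec_eq_one _ h.primitive

theorem IsPrimitiveIsotropic.weyl₁ {x : Fin 5 → ℤ} (h : IsPrimitiveIsotropic x) :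
    IsPrimitiveIsotropic (tilde weyl₁ *ᵥ x) where
  isotropic := by
    rw [tilde_weyl₁_mulVec]
    simp
    linear_combination h.isotropic
  primitive := exists_dotProduct_tilde_mulVec_eq_one _ h.primitive

theorem IsPrimitiveIsotropic.weyl₂ {x : Fin 5 → ℤ} (h : IsPrimitiveIsotropic x) :
    IsPrimitiveIsotropic (tilde weyl₂ *ᵥ x) where
  isotropic := by
    rw [tilde_weyl₂_mulVec]
    simp
    linear_combination h.isotropic
  primitive := exists_dotProduct_tilde_mulVec_eq_one _ h.primitive

/-- Elementary matrices can move `x` to the first basis vector. -/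
def Reducible (x : Fin 5 → ℤ) : Prop :=
  ∃ M ∈ elementary, tilde M *ᵥ x = ![1, 0, 0, 0, 0]

theorem Reducible.of_mulVec {M : Γ₂} (hM : M ∈ elementary) {x : Fin 5 → ℤ}
    (h : Reducible (tilde M *ᵥ x)) : Reducible x := by
  obtain ⟨M', hM', h⟩ := h
  exact ⟨M' * M, mul_mem hM' hM, by rw [tilde_mul_mulVec, h]⟩

theorem exists_two_mul_abs_add_mul_le (a : ℤ) {b : ℤ} (hb : b ≠ 0) :
    ∃ t : ℤ, 2 * |a + t * b| ≤ |b| := by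
  refine ⟨-round ((a : ℚ) / b), ?_⟩
  have h := abs_sub_round ((a : ℚ) / b)
  have hb' : (b : ℚ) ≠ 0 := by exact_mod_cast hb
  have h2 : (a : ℚ) + (-round ((a : ℚ) / b) : ℤ) * b = ((a : ℚ) / b - round ((a : ℚ) / b)) * b := by
    push_cast
    field_simp
    ring
  have h3 : (2 : ℚ) * |(a : ℚ) + (-round ((a : ℚ) / b) : ℤ) * b| ≤ |(b : ℚ)| := by
    rw [h2, abs_mul]
    nlinarith [abs_nonneg (b : ℚ)]
  exact_mod_cast h3

/-- Descent on `|x₄|`: a translation makes `x₁`, `x₂`, `x₃` small modulo `x₄`, then `x₀` is small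
because `x` is isotropic, and a Weyl element brings a non-zero small coordinate to the last
place. -/
theorem reducible_of_ne_zero {x : Fin 5 → ℤ} (hx : IsPrimitiveIsotropic x) (h4 : x 4 ≠ 0) :
    Reducible x := by
  induction hn : (x 4).natAbs using Nat.strong_induction_on generalizing x with
  | _ n ih =>
  obtain ⟨p, hp⟩ := exists_two_mul_abs_add_mul_le (x 1) h4
  obtain ⟨q, hq⟩ := exists_two_mul_abs_add_mul_le (x 2) h4
  obtain ⟨r, hr⟩ := exists_two_mul_abs_add_mul_le (x 3) h4
  refine Reducible.of_mulVec (transUp_mem p q r) ?_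
  have hy := hx.transUp p q r
  have e1 : (tilde (transUp p q r) *ᵥ x) 1 = x 1 + p * x 4 := by rw [tilde_transUp_mulVec]; rfl
  have e2 : (tilde (transUp p q r) *ᵥ x) 2 = x 2 + q * x 4 := by rw [tilde_transUp_mulVec]; rfl
  have e3 : (tilde (transUp p q r) *ᵥ x) 3 = x 3 + r * x 4 := by rw [tilde_transUp_mulVec]; rfl
  have e4 : (tilde (transUp p q r) *ᵥ x) 4 = x 4 := by rw [tilde_transUp_mulVec]; rfl
  rw [← e1] at hp
  rw [← e2] at hq
  rw [← e3] at hr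
  rw [← e4] at h4 hp hq hr hn
  generalize tilde (transUp p q r) *ᵥ x = y at *
  clear e1 e2 e3 e4 hx
  have h4' := abs_pos.2 h4
  by_cases h1 : y 1 = 0
  · by_cases h3 : y 3 = 0
    · by_cases h0 : y 0 = 0
      · have h2 : y 2 = 0 := by
          have := hy.isotropic
          rw [h0, h1] at this
          simpa using this.symm
        obtain ⟨z, hz⟩ := hy.primitive
        simp only [dotProduct, Fin.sum_univ_five, h0, h1, h2, h3, mul_zero, zero_add] at hz
        refine Reducible.of_mulVec weyl₂_mem (Reducible.of_mulVec weyl₁_mem ?_)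
        have hv : tilde weyl₁ *ᵥ (tilde weyl₂ *ᵥ y) = ![-y 4, 0, 0, 0, 0] := by
          rw [tilde_weyl₂_mulVec, tilde_weyl₁_mulVec]
          simp [h0, h1, h2, h3]
        rw [hv]
        rcases Int.isUnit_iff.1 (IsUnit.of_mul_eq_one_right _ hz) with h | h
        · refine Reducible.of_mulVec weyl₁_mem (Reducible.of_mulVec weyl₁_mem ⟨1, one_mem _, ?_⟩)
          rw [tilde_one, Matrix.one_mulVec, tilde_weyl₁_mulVec, tilde_weyl₁_mulVec]
          simp [h]
        · exact ⟨1, one_mem _, by rw [tilde_one, Matrix.one_mulVec, h]; rfl⟩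
      · refine Reducible.of_mulVec weyl₂_mem (Reducible.of_mulVec weyl₁_mem ?_)
        have hv : (tilde weyl₁ *ᵥ (tilde weyl₂ *ᵥ y)) 4 = -y 0 := by
          rw [tilde_weyl₂_mulVec, tilde_weyl₁_mulVec]
          simp
        refine ih _ ?_ hy.weyl₂.weyl₁ (by rw [hv]; simpa using h0) rfl
        rw [hv, ← hn]
        zify
        rw [abs_neg]
        have hq0 := hy.isotropic
        rw [h1, zero_mul, add_zero] at hq0
        have h5 := congrArg abs hq0
        rw [abs_mul, abs_pow] at h5
        nlinarith [abs_nonneg (y 2), abs_nonneg (y 0)]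
    · refine Reducible.of_mulVec weyl₂_mem ?_
      have hv : (tilde weyl₂ *ᵥ y) 4 = -y 3 := by rw [tilde_weyl₂_mulVec]; rfl
      refine ih _ ?_ hy.weyl₂ (by rw [hv]; simpa using h3) rfl
      rw [hv, ← hn]
      zify
      rw [abs_neg]
      linarith
  · refine Reducible.of_mulVec weyl₁_mem ?_
    have hv : (tilde weyl₁ *ᵥ y) 4 = -y 1 := by rw [tilde_weyl₁_mulVec]; rfl
    refine ih _ ?_ hy.weyl₁ (by rw [hv]; simpa using h1) rfl
    rw [hv, ← hn]
    zify
    rw [abs_neg]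
    linarith

/-- The group generated by the elementary matrices acts transitively on the primitive isotropic
vectors. -/
theorem IsPrimitiveIsotropic.reducible {x : Fin 5 → ℤ} (hx : IsPrimitiveIsotropic x) :
    Reducible x := by
  by_cases h4 : x 4 = 0
  · by_cases h1 : x 1 = 0
    · by_cases h3 : x 3 = 0
      · have h2 : x 2 = 0 := by
          have := hx.isotropic
          rw [h4, h1] at this
          simpa using this.symm
        have h0 : x 0 ≠ 0 := by
          intro h0
          obtain ⟨z, hz⟩ := hx.primitive
          simp [dotProduct, Fin.sum_univ_five, h0, h1, h2, h3, h4] at hz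
        refine Reducible.of_mulVec weyl₂_mem (Reducible.of_mulVec weyl₁_mem ?_)
        refine reducible_of_ne_zero hx.weyl₂.weyl₁ ?_
        rw [tilde_weyl₂_mulVec, tilde_weyl₁_mulVec]
        simpa using h0
      · refine Reducible.of_mulVec weyl₂_mem (reducible_of_ne_zero hx.weyl₂ ?_)
        rw [tilde_weyl₂_mulVec]
        simpa using h3
    · refine Reducible.of_mulVec weyl₁_mem (reducible_of_ne_zero hx.weyl₁ ?_)
      rw [tilde_weyl₁_mulVec]
      simpa using h1
  · exact reducible_of_ne_zero hx h4

theorem mulVec_single_eq (U : Matrix (Fin 5) (Fin 5) ℤ) :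
    U *ᵥ ![1, 0, 0, 0, 0] = ![U 0 0, U 1 0, U 2 0, U 3 0, U 4 0] := by
  ext i
  fin_cases i <;> simp [Matrix.mulVec, dotProduct, Fin.sum_univ_five]

/-- The first column of `M̃` is primitive and isotropic. -/
theorem isPrimitiveIsotropic_tilde (M : Γ₂) :
    IsPrimitiveIsotropic (tilde M *ᵥ ![1, 0, 0, 0, 0]) where
  isotropic := by
    have e := congrFun (congrFun M.relations.2.2.1 0) 1
    simp only [Matrix.mul_apply, Fin.sum_univ_two, Matrix.transpose_apply] at e
    rw [mulVec_single_eq, tilde_eq]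
    simp
    linear_combination (M.A 0 1 * M.C 0 0 - M.A 0 0 * M.C 0 1) * e
  primitive := exists_dotProduct_tilde_mulVec_eq_one _ ⟨![1, 0, 0, 0, 0], by simp⟩

/-- An element of `Γ₂(ℤ)` that fixes the first basis vector has `det A = 1` and `C = 0`, so it is
a product of some `(I, S; 0, I)` and `diag(A, A^{-t})`. -/
theorem mem_elementary_of_fixes {M : Γ₂} (h : tilde M *ᵥ ![1, 0, 0, 0, 0] = ![1, 0, 0, 0, 0]) :
    M ∈ elementary := by
  rw [mulVec_single_eq, tilde_eq] at h
  simp only [Matrix.of_apply, Matrix.cons_val, Matrix.cons_val_zero, Matrix.cons_val_one,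
    Matrix.vecCons_inj, and_true] at h
  obtain ⟨h0, h1, h2, h3, -⟩ := h
  obtain ⟨r1, r2, r3, r4, r5⟩ := M.relations
  have e3 := congrFun (congrFun r3 0) 1
  simp only [Matrix.mul_apply, Fin.sum_univ_two, Matrix.transpose_apply] at e3
  have hdet : M.A.det = 1 := by rw [Matrix.det_fin_two]; exact h0
  -- `A C^♯ = 0` and `det A = 1` force `C = 0`
  have hC : M.C = 0 := by
    ext i j
    fin_cases i <;> fin_cases j <;> simp
    · linear_combination -M.C 0 0 * h0 - M.A 0 0 * h3 + M.A 1 0 * h2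
    · linear_combination -M.C 0 1 * h0 - M.A 0 1 * h3 + M.A 1 1 * h2
    · linear_combination -M.C 1 0 * h0 - M.A 1 0 * h1 - M.A 0 0 * (e3 - h2)
    · linear_combination -M.C 1 1 * h0 - M.A 1 1 * h1 - M.A 0 1 * (e3 - h2)
  let V : SpecialLinearGroup (Fin 2) ℤ := ⟨M.A, hdet⟩
  have hu : ∃ p q r, M * levi V⁻¹ = transUp p q r := by
    have hD : M.D * M.Aᵀ = 1 := by
      rw [hC, Matrix.transpose_zero, Matrix.zero_mul, sub_zero] at r5
      exact mul_eq_one_comm.1 r5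
    have hV : M.A * ((V⁻¹ : SpecialLinearGroup (Fin 2) ℤ) : Matrix (Fin 2) (Fin 2) ℤ) = 1 :=
      congrArg Subtype.val (mul_inv_cancel V)
    have hW : (levi V⁻¹).D = M.Aᵀ := by
      rw [map_inv]
      exact (levi V).inv_blocks.2.2.2
    obtain ⟨m1, m2, m3, m4⟩ := M.mul_blocks (levi V⁻¹)
    obtain ⟨l1, l2, l3, -⟩ := levi_blocks V⁻¹
    rw [l1, l3, hV, Matrix.mul_zero, add_zero] at m1
    rw [l2, hW, Matrix.mul_zero, zero_add] at m2
    rw [l3, hC, Matrix.zero_mul, Matrix.mul_zero, add_zero] at m3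
    rw [hC, hW, hD, Matrix.zero_mul, zero_add] at m4
    refine ⟨(M.B * M.Aᵀ) 0 0, (M.B * M.Aᵀ) 0 1, (M.B * M.Aᵀ) 1 1, Subtype.ext ?_⟩
    rw [(M * levi V⁻¹).eq_fromBlocks, m1, m2, m3, m4]
    change _ = fromBlocks _ _ _ _
    have hs : (M.B * M.Aᵀ) 1 0 = (M.B * M.Aᵀ) 0 1 := by
      rw [← Matrix.transpose_apply (M.B * M.Aᵀ), Matrix.transpose_mul, Matrix.transpose_transpose,
        r1]
    congr 1
    ext i j
    fin_cases i <;> fin_cases j <;> simp [hs]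
  obtain ⟨p, q, r, hu⟩ := hu
  have hM : M = transUp p q r * levi V := by
    rw [← hu, mul_assoc, ← map_mul, inv_mul_cancel, map_one, mul_one]
  rw [hM]
  exact mul_mem (transUp_mem _ _ _) (levi_mem _)

theorem elementary_eq_top : elementary = ⊤ := by
  refine eq_top_iff.2 fun M _ => ?_
  obtain ⟨M', hM', h⟩ := (isPrimitiveIsotropic_tilde M).reducible
  rw [← tilde_mul_mulVec] at h
  exact (Subgroup.mul_mem_cancel_left _ hM').1 (mem_elementary_of_fixes h)

/-! ### The identity component -/

theorem mem_SO_iff {m : ℕ} {T : Matrix (Fin m) (Fin m) ℝ} {U : SpecialLinearGroup (Fin m) ℝ} :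
    U ∈ SO T ↔ (U : Matrix (Fin m) (Fin m) ℝ)ᵀ * T * (U : Matrix (Fin m) (Fin m) ℝ) = T :=
  Iff.rfl

/-- The identity component of `SO(T)`, described by preconnected sets in the ambient group
`SL_m(ℝ)`. -/
theorem mem_SO₀_iff {m : ℕ} {T : Matrix (Fin m) (Fin m) ℝ} {U : SpecialLinearGroup (Fin m) ℝ} :
    U ∈ SO₀ T ↔ ∃ s : Set (SpecialLinearGroup (Fin m) ℝ), IsPreconnected s ∧
      s ⊆ (SO T : Set (SpecialLinearGroup (Fin m) ℝ)) ∧ 1 ∈ s ∧ U ∈ s := by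
  constructor
  · rintro ⟨V, hV, rfl⟩
    refine ⟨Subtype.val '' connectedComponent (1 : SO T),
      isPreconnected_connectedComponent.image _ continuous_subtype_val.continuousOn, ?_,
      ⟨1, mem_connectedComponent, rfl⟩, ⟨V, hV, rfl⟩⟩
    rintro _ ⟨W, -, rfl⟩
    exact W.2
  · rintro ⟨s, hs, hsT, h1, hU⟩
    refine ⟨⟨U, hsT hU⟩, ?_, rfl⟩
    have hp : IsPreconnected (Subtype.val ⁻¹' s : Set (SO T)) := by
      rw [← Topology.IsInducing.subtypeVal.isPreconnected_image]
      convert hs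
      ext V
      exact ⟨fun ⟨_, hW, h⟩ => h ▸ hW, fun hV => ⟨⟨V, hsT hV⟩, hV, rfl⟩⟩
    exact hp.subset_connectedComponent (show (1 : SO T) ∈ Subtype.val ⁻¹' s from h1) hU

theorem SO₀_le_SO {m : ℕ} (T : Matrix (Fin m) (Fin m) ℝ) : SO₀ T ≤ SO T := by
  intro U hU
  obtain ⟨s, -, hs, -, h⟩ := mem_SO₀_iff.1 hU
  exact hs h

/-- A continuous map of `SL_m(ℝ)` that fixes `1` and maps `SO(T)` to `SO(T')` maps the identity
components to each other. -/
theorem map_mem_SO₀ {m : ℕ} {T T' : Matrix (Fin m) (Fin m) ℝ}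
    {f : SpecialLinearGroup (Fin m) ℝ → SpecialLinearGroup (Fin m) ℝ} (hf : Continuous f)
    (h1 : f 1 = 1) (h : ∀ U ∈ SO T, f U ∈ SO T') {U : SpecialLinearGroup (Fin m) ℝ}
    (hU : U ∈ SO₀ T) : f U ∈ SO₀ T' := by
  obtain ⟨s, hs, hsT, hs1, hsU⟩ := mem_SO₀_iff.1 hU
  refine mem_SO₀_iff.2 ⟨f '' s, hs.image _ hf.continuousOn, ?_, ⟨1, hs1, h1⟩, ⟨U, hsU, rfl⟩⟩
  rintro _ ⟨V, hV, rfl⟩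
  exact h V (hsT hV)

theorem mem_SO₀_of_path {m : ℕ} {T : Matrix (Fin m) (Fin m) ℝ}
    {P : ℝ → Matrix (Fin m) (Fin m) ℝ} (hP : Continuous P) (hdet : ∀ t, (P t).det = 1)
    (hT : ∀ t, (P t)ᵀ * T * P t = T) (h0 : P 0 = 1) {U : SpecialLinearGroup (Fin m) ℝ}
    (hU : P 1 = U) : U ∈ SO₀ T := by
  refine mem_SO₀_iff.2 ⟨Set.range fun t => (⟨P t, hdet t⟩ : SpecialLinearGroup (Fin m) ℝ),
    isPreconnected_range (hP.subtype_mk _), ?_, ⟨0, Subtype.ext h0⟩, ⟨1, Subtype.ext hU⟩⟩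
  rintro _ ⟨t, rfl⟩
  exact hT t

theorem S₁_map : S₁.map (Int.cast : ℤ → ℝ) =
    !![0, 0, 0, 0, 1; 0, 0, 0, 1, 0; 0, 0, -2, 0, 0; 0, 1, 0, 0, 0; 1, 0, 0, 0, 0] := by
  rw [S₁_eq]
  ext i j
  fin_cases i <;> fin_cases j <;> simp

theorem mem_SO_S₁_of_mem {U : SpecialLinearGroup (Fin 5) ℤ} (hU : U ∈ discKernel S₁) :
    (U : Matrix (Fin 5) (Fin 5) ℤ)ᵀ * S₁ * (U : Matrix (Fin 5) (Fin 5) ℤ) = S₁ := by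
  have h := SO₀_le_SO _ hU.1
  rw [mem_SO_iff] at h
  have h2 : ((U : Matrix (Fin 5) (Fin 5) ℤ)ᵀ * S₁ * (U : Matrix (Fin 5) (Fin 5) ℤ)).map
      (Int.castRingHom ℝ) = S₁.map (Int.castRingHom ℝ) := by
    rw [Matrix.map_mul, Matrix.map_mul, Matrix.transpose_map]
    exact h
  exact Matrix.map_injective (RingHom.injective_int _) h2

/-- The entries of `Uᵗ S₁ U`, over any commutative ring. -/
theorem transpose_mul_mul_apply {R : Type*} [CommRing R] (U : Matrix (Fin 5) (Fin 5) R)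
    (i j : Fin 5) :
    (Uᵀ * !![0, 0, 0, 0, 1; 0, 0, 0, 1, 0; 0, 0, -2, 0, 0; 0, 1, 0, 0, 0; 1, 0, 0, 0, 0] * U :
      Matrix (Fin 5) (Fin 5) R) i j =
      U 0 i * U 4 j + U 4 i * U 0 j + U 1 i * U 3 j + U 3 i * U 1 j - 2 * (U 2 i * U 2 j) := by
  simp only [Matrix.mul_apply, Fin.sum_univ_five, Matrix.transpose_apply, Matrix.of_apply,
    Matrix.cons_val, Matrix.cons_val_zero, Matrix.cons_val_one]
  ring

/-- The values of the bilinear form of `S₁` at `U f₁`, `U f₂` and `f₁`, `f₂`, where `f₁`, `f₂` is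
the orthogonal basis `e₀ + e₄`, `e₁ + e₃` of a maximal positive definite subspace. -/
def positivePairing (U : Matrix (Fin 5) (Fin 5) ℝ) : Matrix (Fin 2) (Fin 2) ℝ :=
  !![U 0 0 + U 0 4 + U 4 0 + U 4 4, U 1 0 + U 1 4 + U 3 0 + U 3 4;
    U 0 1 + U 0 3 + U 4 1 + U 4 3, U 1 1 + U 1 3 + U 3 1 + U 3 3]

/-- An orthogonal map sends a maximal positive definite subspace to one that meets the negative
definite orthogonal complement of the first in `0`. -/
theorem det_positivePairing_ne_zero {U : Matrix (Fin 5) (Fin 5) ℝ}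
    (hU : Uᵀ * S₁.map (Int.cast : ℤ → ℝ) * U = S₁.map (Int.cast : ℤ → ℝ)) :
    (positivePairing U).det ≠ 0 := by
  intro h
  obtain ⟨v, hv, h⟩ := Matrix.exists_vecMul_eq_zero_iff.2 h
  have e0 := congrFun h 0
  have e1 := congrFun h 1
  simp [positivePairing, Matrix.vecMul, dotProduct] at e0 e1
  have q := fun i j => congrFun (congrFun hU i) j
  rw [S₁_map] at q
  simp only [transpose_mul_mul_apply] at q
  have q00 := (q 0 0).trans (show _ = (0 : ℝ) from rfl)
  have q04 := (q 0 4).trans (show _ = (1 : ℝ) from rfl)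
  have q44 := (q 4 4).trans (show _ = (0 : ℝ) from rfl)
  have q11 := (q 1 1).trans (show _ = (0 : ℝ) from rfl)
  have q13 := (q 1 3).trans (show _ = (1 : ℝ) from rfl)
  have q33 := (q 3 3).trans (show _ = (0 : ℝ) from rfl)
  have q01 := (q 0 1).trans (show _ = (0 : ℝ) from rfl)
  have q03 := (q 0 3).trans (show _ = (0 : ℝ) from rfl)
  have q41 := (q 4 1).trans (show _ = (0 : ℝ) from rfl)
  have q43 := (q 4 3).trans (show _ = (0 : ℝ) from rfl)
  obtain ⟨z, hz⟩ : ∃ z : Fin 5 → ℝ,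
      ∀ k, z k = v 0 * (U k 0 + U k 4) + v 1 * (U k 1 + U k 3) := ⟨_, fun _ => rfl⟩
  have hq : v 0 ^ 2 + v 1 ^ 2 = z 0 * z 4 + z 1 * z 3 - z 2 ^ 2 := by
    rw [hz, hz, hz, hz, hz]
    linear_combination -v 0 ^ 2 * ((q00 + q44) / 2 + q04) - v 1 ^ 2 * ((q11 + q33) / 2 + q13)
      - v 0 * v 1 * (q01 + q03 + q41 + q43)
  have h4 : z 4 = -z 0 := by
    rw [hz, hz]
    linear_combination e0
  have h3 : z 3 = -z 1 := by
    rw [hz, hz]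
    linear_combination e1
  have hs : v 0 ^ 2 + v 1 ^ 2 + (z 0 ^ 2 + z 1 ^ 2 + z 2 ^ 2) = 0 := by
    rw [hq, h3, h4]
    ring
  have hv0 : v 0 = 0 := by
    refine pow_eq_zero_iff two_ne_zero |>.1 (le_antisymm ?_ (sq_nonneg _))
    linarith only [hs, sq_nonneg (z 0), sq_nonneg (z 1), sq_nonneg (z 2), sq_nonneg (v 1)]
  have hv1 : v 1 = 0 := by
    refine pow_eq_zero_iff two_ne_zero |>.1 (le_antisymm ?_ (sq_nonneg _))
    linarith only [hs, sq_nonneg (z 0), sq_nonneg (z 1), sq_nonneg (z 2), sq_nonneg (v 0)]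
  refine hv (funext fun i => ?_)
  fin_cases i
  · exact hv0
  · exact hv1

/-- The sign of `det (positivePairing U)` is constant on the identity component. -/
theorem det_positivePairing_pos {U : SpecialLinearGroup (Fin 5) ℝ}
    (hU : U ∈ SO₀ (S₁.map (Int.cast : ℤ → ℝ))) : 0 < (positivePairing U).det := by
  obtain ⟨s, hs, hsT, h1, hsU⟩ := mem_SO₀_iff.1 hU
  by_contra hneg
  have hc : Continuous fun V : SpecialLinearGroup (Fin 5) ℝ => (positivePairing V).det := by
    simp only [positivePairing, Matrix.det_fin_two_of]
    have := fun i j : Fin 5 => (continuous_subtype_val.matrix_elem i j :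
      Continuous fun V : SpecialLinearGroup (Fin 5) ℝ => V i j)
    fun_prop
  have h0 : (0 : ℝ) ∈ Set.Icc ((positivePairing U).det)
      ((positivePairing (1 : SpecialLinearGroup (Fin 5) ℝ)).det) := by
    refine ⟨not_lt.1 hneg, ?_⟩
    simp [positivePairing, Matrix.det_fin_two_of]
  obtain ⟨V, hV, h⟩ := hs.intermediate_value hsU h1 hc.continuousOn h0
  exact det_positivePairing_ne_zero (hsT hV) h

/-! ### Antidiagonal forms and divisibility -/

/-- The matrix with the entries `g j` at the places `(j.rev, j)` of the antidiagonal. -/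
def antidiagonal (g : Fin 5 → ℤ) : Matrix (Fin 5) (Fin 5) ℤ :=
  Matrix.of fun k j => if k = j.rev then g j else 0

theorem S₁_eq_antidiagonal : S₁ = antidiagonal ![1, 1, -2, 1, 1] := by
  decide

/-- Products `diag(f) X S` with an antidiagonal matrix `S` are characterized by entrywise
divisibility. -/
theorem exists_eq_diagonal_mul_mul_antidiagonal_iff (f g : Fin 5 → ℤ)
    (A : Matrix (Fin 5) (Fin 5) ℤ) :
    (∃ X : Matrix (Fin 5) (Fin 5) ℤ, A = diagonal f * X * antidiagonal g) ↔
      ∀ i j, f i * g j ∣ A i j := by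
  have key : ∀ (X : Matrix (Fin 5) (Fin 5) ℤ) i j,
      (diagonal f * X * antidiagonal g) i j = f i * g j * X i j.rev := by
    intro X i j
    rw [Matrix.mul_apply]
    simp only [antidiagonal, Matrix.of_apply, mul_ite, mul_zero, Finset.sum_ite_eq',
      Finset.mem_univ, if_true, Matrix.diagonal_mul]
    ring
  constructor
  · rintro ⟨X, rfl⟩ i j
    exact ⟨_, key X i j⟩
  · intro h
    choose X hX using h
    refine ⟨Matrix.of fun i j => X i j.rev, ?_⟩
    ext i j
    rw [key, hX]
    simp

theorem exists_eq_one_add_mul_antidiagonal_iff (g : Fin 5 → ℤ) (U : Matrix (Fin 5) (Fin 5) ℤ) :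
    (∃ X : Matrix (Fin 5) (Fin 5) ℤ, U = 1 + X * antidiagonal g) ↔
      ∀ i j, g j ∣ (U - 1) i j := by
  have h := exists_eq_diagonal_mul_mul_antidiagonal_iff 1 g (U - 1)
  simp only [Pi.one_def, Matrix.diagonal_one, one_mul] at h
  rw [← h]
  simp only [sub_eq_iff_eq_add, add_comm]

/-! ### One-parameter families in the orthogonal group -/

section Families

variable {R : Type*} [CommRing R]

/-- The image of `(I, S; 0, I)`, `S = (p, q; q, r)`, in the orthogonal group. -/
def upMatrix (p q r : R) : Matrix (Fin 5) (Fin 5) R :=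
  !![1, -r, 2 * q, -p, q ^ 2 - p * r; 0, 1, 0, 0, p; 0, 0, 1, 0, q; 0, 0, 0, 1, r; 0, 0, 0, 0, 1]

/-- The image of `(I, 0; S, I)`, `S = (p, q; q, r)`, in the orthogonal group. -/
def lowMatrix (p q r : R) : Matrix (Fin 5) (Fin 5) R :=
  !![1, 0, 0, 0, 0; -r, 1, 0, 0, 0; q, 0, 1, 0, 0; -p, 0, 0, 1, 0; q ^ 2 - p * r, p, 2 * q, r, 1]

/-- The image of `diag(V, V^{-t})`, `V = (1, t; 0, 1)`, in the orthogonal group. -/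
def shearUpMatrix (t : R) : Matrix (Fin 5) (Fin 5) R :=
  !![1, 0, 0, 0, 0; 0, 1, 2 * t, t ^ 2, 0; 0, 0, 1, t, 0; 0, 0, 0, 1, 0; 0, 0, 0, 0, 1]

/-- The image of `diag(V, V^{-t})`, `V = (1, 0; t, 1)`, in the orthogonal group. -/
def shearLowMatrix (t : R) : Matrix (Fin 5) (Fin 5) R :=
  !![1, 0, 0, 0, 0; 0, 1, 0, 0, 0; 0, t, 1, 0, 0; 0, t ^ 2, 2 * t, 1, 0; 0, 0, 0, 0, 1]

theorem det_upMatrix (p q r : R) : (upMatrix p q r).det = 1 := by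
  simp [upMatrix, Matrix.det_succ_column_zero, Fin.sum_univ_succ]

theorem det_lowMatrix (p q r : R) : (lowMatrix p q r).det = 1 := by
  simp [lowMatrix, Matrix.det_succ_row_zero, Fin.sum_univ_succ]

theorem det_shearUpMatrix (t : R) : (shearUpMatrix t).det = 1 := by
  simp [shearUpMatrix, Matrix.det_succ_column_zero, Fin.sum_univ_succ]

theorem det_shearLowMatrix (t : R) : (shearLowMatrix t).det = 1 := by
  simp [shearLowMatrix, Matrix.det_succ_row_zero, Fin.sum_univ_succ]

end Families

/-- `M̃` belongs to the identity component as soon as it is the value at `1` of a one-parameter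
family of orthogonal matrices that starts at the identity. -/
theorem exists_mem_discKernel_of_path {M : Γ₂} {P : ℝ → Matrix (Fin 5) (Fin 5) ℝ}
    (hP : Continuous P) (hdet : ∀ t, (P t).det = 1)
    (hT : ∀ t i j, P t 0 i * P t 4 j + P t 4 i * P t 0 j + P t 1 i * P t 3 j + P t 3 i * P t 1 j
      - 2 * (P t 2 i * P t 2 j) = S₁.map (Int.cast : ℤ → ℝ) i j)
    (h0 : P 0 = 1) (h1 : P 1 = (tilde M).map (Int.cast : ℤ → ℝ))
    (hM : ∀ i j, (![1, 1, -2, 1, 1] : Fin 5 → ℤ) j ∣ (tilde M - 1) i j) :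
    ∃ U ∈ discKernel S₁, (U : Matrix (Fin 5) (Fin 5) ℤ) = tilde M := by
  have hd : (tilde M).det = 1 := by
    have h := hdet 1
    rw [h1] at h
    have h2 : ((tilde M).det : ℝ) = 1 := by
      rw [← h]
      exact (RingHom.map_det (Int.castRingHom ℝ) (tilde M))
    exact_mod_cast h2
  refine ⟨⟨tilde M, hd⟩, ⟨?_, ?_⟩, rfl⟩
  · refine mem_SO₀_of_path hP hdet (fun t => ?_) h0 h1
    ext i j
    rw [← hT t i j, S₁_map, transpose_mul_mul_apply]
  · rw [S₁_eq_antidiagonal]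
    exact (exists_eq_one_add_mul_antidiagonal_iff _ _).2 hM

theorem exists_mem_discKernel_transUp (p q r : ℤ) :
    ∃ U ∈ discKernel S₁, (U : Matrix (Fin 5) (Fin 5) ℤ) = tilde (transUp p q r) := by
  refine exists_mem_discKernel_of_path (P := fun t => upMatrix (t * p) (t * q) (t * r)) ?_
    (fun t => det_upMatrix _ _ _) ?_ ?_ ?_ ?_
  · refine continuous_matrix fun i j => ?_
    fin_cases i <;> fin_cases j <;> simp [upMatrix] <;> fun_prop
  · intro t i j
    rw [S₁_map]
    fin_cases i <;> fin_cases j <;> simp [upMatrix] <;> ring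
  · ext i j
    fin_cases i <;> fin_cases j <;> simp [upMatrix]
  · rw [tilde_transUp]
    ext i j
    fin_cases i <;> fin_cases j <;> simp [upMatrix]
  · rw [tilde_transUp]
    intro i j
    fin_cases i <;> fin_cases j <;> simp

theorem exists_mem_discKernel_transLow (p q r : ℤ) :
    ∃ U ∈ discKernel S₁, (U : Matrix (Fin 5) (Fin 5) ℤ) = tilde (transLow p q r) := by
  refine exists_mem_discKernel_of_path (P := fun t => lowMatrix (t * p) (t * q) (t * r)) ?_
    (fun t => det_lowMatrix _ _ _) ?_ ?_ ?_ ?_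
  · refine continuous_matrix fun i j => ?_
    fin_cases i <;> fin_cases j <;> simp [lowMatrix] <;> fun_prop
  · intro t i j
    rw [S₁_map]
    fin_cases i <;> fin_cases j <;> simp [lowMatrix] <;> ring
  · ext i j
    fin_cases i <;> fin_cases j <;> simp [lowMatrix]
  · rw [tilde_transLow]
    ext i j
    fin_cases i <;> fin_cases j <;> simp [lowMatrix]
  · rw [tilde_transLow]
    intro i j
    fin_cases i <;> fin_cases j <;> simp

/-- The matrix `(1, t; 0, 1)` of `SL₂(ℤ)`. -/
def shearUp (t : ℤ) : SpecialLinearGroup (Fin 2) ℤ := ⟨!![1, t; 0, 1], by simp⟩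

/-- The matrix `(1, 0; t, 1)` of `SL₂(ℤ)`. -/
def shearLow (t : ℤ) : SpecialLinearGroup (Fin 2) ℤ := ⟨!![1, 0; t, 1], by simp⟩

theorem tilde_levi_shearUp (t : ℤ) : tilde (levi (shearUp t)) = shearUpMatrix t := by
  have h : (shearUp t : Matrix (Fin 2) (Fin 2) ℤ) = !![1, t; 0, 1] := rfl
  rw [tilde_levi, h]
  simp [shearUpMatrix]

theorem tilde_levi_shearLow (t : ℤ) : tilde (levi (shearLow t)) = shearLowMatrix t := by
  have h : (shearLow t : Matrix (Fin 2) (Fin 2) ℤ) = !![1, 0; t, 1] := rfl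
  rw [tilde_levi, h]
  simp [shearLowMatrix]

theorem exists_mem_discKernel_levi_shearUp (t : ℤ) :
    ∃ U ∈ discKernel S₁, (U : Matrix (Fin 5) (Fin 5) ℤ) =
      tilde (levi (shearUp t)) := by
  refine exists_mem_discKernel_of_path (P := fun s => shearUpMatrix (s * t)) ?_
    (fun s => det_shearUpMatrix _) ?_ ?_ ?_ ?_
  · refine continuous_matrix fun i j => ?_
    fin_cases i <;> fin_cases j <;> simp [shearUpMatrix] <;> fun_prop
  · intro s i j
    rw [S₁_map]
    fin_cases i <;> fin_cases j <;> simp [shearUpMatrix] <;> ring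
  · ext i j
    fin_cases i <;> fin_cases j <;> simp [shearUpMatrix]
  · rw [tilde_levi_shearUp]
    ext i j
    fin_cases i <;> fin_cases j <;> simp [shearUpMatrix]
  · rw [tilde_levi_shearUp]
    intro i j
    fin_cases i <;> fin_cases j <;> simp [shearUpMatrix]

theorem exists_mem_discKernel_levi_shearLow (t : ℤ) :
    ∃ U ∈ discKernel S₁, (U : Matrix (Fin 5) (Fin 5) ℤ) =
      tilde (levi (shearLow t)) := by
  refine exists_mem_discKernel_of_path (P := fun s => shearLowMatrix (s * t)) ?_
    (fun s => det_shearLowMatrix _) ?_ ?_ ?_ ?_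
  · refine continuous_matrix fun i j => ?_
    fin_cases i <;> fin_cases j <;> simp [shearLowMatrix] <;> fun_prop
  · intro s i j
    rw [S₁_map]
    fin_cases i <;> fin_cases j <;> simp [shearLowMatrix] <;> ring
  · ext i j
    fin_cases i <;> fin_cases j <;> simp [shearLowMatrix]
  · rw [tilde_levi_shearLow]
    ext i j
    fin_cases i <;> fin_cases j <;> simp [shearLowMatrix]
  · rw [tilde_levi_shearLow]
    intro i j
    fin_cases i <;> fin_cases j <;> simp [shearLowMatrix]

/-- The elements of `Γ₂(ℤ)` whose image lies in the discriminant kernel (all of them). -/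
def liftable : Subgroup Γ₂ where
  carrier := {M | ∃ U ∈ discKernel S₁, (U : Matrix (Fin 5) (Fin 5) ℤ) = tilde M}
  one_mem' := ⟨1, one_mem _, tilde_one.symm⟩
  mul_mem' := by
    rintro M M' ⟨U, hU, h⟩ ⟨U', hU', h'⟩
    refine ⟨U * U', mul_mem hU hU', ?_⟩
    rw [tilde_mul, ← h, ← h']
    rfl
  inv_mem' := by
    rintro M ⟨U, hU, h⟩
    refine ⟨U⁻¹, inv_mem hU, ?_⟩
    have h1 : ((U⁻¹ : SpecialLinearGroup (Fin 5) ℤ) : Matrix (Fin 5) (Fin 5) ℤ) *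
        (U : Matrix (Fin 5) (Fin 5) ℤ) = 1 := congrArg Subtype.val (inv_mul_cancel U)
    have h2 : tilde M * tilde M⁻¹ = 1 := by rw [← tilde_mul, mul_inv_cancel, tilde_one]
    rw [h] at h1
    exact left_inv_eq_right_inv h1 h2

theorem levi_mem_liftable (V : SpecialLinearGroup (Fin 2) ℤ) : levi V ∈ liftable := by
  suffices h : (⊤ : Subgroup (SpecialLinearGroup (Fin 2) ℤ)) ≤ liftable.comap levi from
    h (Subgroup.mem_top V)
  rw [← _root_.SpecialLinearGroup.SL2Z_generators, Subgroup.closure_le]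
  rintro _ (rfl | rfl)
  · have hS : ModularGroup.S = shearUp (-1) * shearLow 1 * shearUp (-1) := by
      decide
    rw [hS]
    exact mul_mem (mul_mem (exists_mem_discKernel_levi_shearUp (-1))
      (exists_mem_discKernel_levi_shearLow 1)) (exists_mem_discKernel_levi_shearUp (-1))
  · exact exists_mem_discKernel_levi_shearUp 1

theorem exists_mem_discKernel (M : Γ₂) :
    ∃ U ∈ discKernel S₁, (U : Matrix (Fin 5) (Fin 5) ℤ) = tilde M := by
  have h : elementary ≤ liftable := by
    refine (Subgroup.closure_le _).2 ?_
    rintro _ ((⟨p, q, r, rfl⟩ | ⟨p, q, r, rfl⟩) | ⟨V, rfl⟩)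
    · exact exists_mem_discKernel_transUp p q r
    · exact exists_mem_discKernel_transLow p q r
    · exact levi_mem_liftable V
  rw [elementary_eq_top] at h
  exact h (Subgroup.mem_top M)

/-- The homomorphism `M ↦ M̃` from `Γ₂(ℤ)` to the discriminant kernel of `S₁`. -/
noncomputable def tildeHom : Γ₂ →* discKernel S₁ where
  toFun M := ⟨(exists_mem_discKernel M).choose, (exists_mem_discKernel M).choose_spec.1⟩
  map_one' := Subtype.ext (Subtype.ext
    ((exists_mem_discKernel 1).choose_spec.2.trans tilde_one))
  map_mul' M M' := by
    refine Subtype.ext (Subtype.ext ((exists_mem_discKernel (M * M')).choose_spec.2.trans ?_))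
    exact (tilde_mul M M').trans (congrArg₂ (· * ·) (exists_mem_discKernel M).choose_spec.2.symm
      (exists_mem_discKernel M').choose_spec.2.symm)

theorem coe_tildeHom (M : Γ₂) : ((tildeHom M : SpecialLinearGroup (Fin 5) ℤ) :
    Matrix (Fin 5) (Fin 5) ℤ) = tilde M :=
  (exists_mem_discKernel M).choose_spec.2

/-! ### Surjectivity -/

/-- The matrix of an element of the discriminant kernel of `S₁`. -/
def mat (U : discKernel S₁) : Matrix (Fin 5) (Fin 5) ℤ :=
  ((U : SpecialLinearGroup (Fin 5) ℤ) : Matrix (Fin 5) (Fin 5) ℤ)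

theorem mat_injective : Function.Injective mat :=
  fun _ _ h => Subtype.ext (Subtype.ext h)

theorem mat_tildeHom_mul_apply (M : Γ₂) (U : discKernel S₁) (i j : Fin 5) :
    mat (tildeHom M * U) i j = (tilde M *ᵥ fun k => mat U k j) i := by
  have h : mat (tildeHom M * U) = tilde M * mat U := by
    rw [← coe_tildeHom]
    rfl
  rw [h, Matrix.mul_apply]
  rfl

theorem mat_form (U : discKernel S₁) (i j : Fin 5) :
    mat U 0 i * mat U 4 j + mat U 4 i * mat U 0 j + mat U 1 i * mat U 3 j + mat U 3 i * mat U 1 j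
      - 2 * (mat U 2 i * mat U 2 j) = S₁ i j := by
  rw [← transpose_mul_mul_apply, ← S₁_eq]
  exact congrFun (congrFun (mem_SO_S₁_of_mem U.2) i) j

theorem exists_dotProduct_col_eq_one (U : discKernel S₁) (j : Fin 5) :
    ∃ y : Fin 5 → ℤ, (y ⬝ᵥ fun k => mat U k j) = 1 := by
  have h : mat U⁻¹ * mat U = 1 := congrArg mat (inv_mul_cancel U)
  refine ⟨mat U⁻¹ j, ?_⟩
  have h1 := congrFun (congrFun h j) j
  rwa [Matrix.mul_apply, Matrix.one_apply_eq] at h1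

theorem det_positivePairing_mat_pos (U : discKernel S₁) :
    0 < (positivePairing ((mat U).map (Int.cast : ℤ → ℝ))).det := by
  have h := det_positivePairing_pos (Subgroup.mem_comap.1 U.2.1)
  have e : ((SpecialLinearGroup.map (Int.castRingHom ℝ) (U : SpecialLinearGroup (Fin 5) ℤ) :
      SpecialLinearGroup (Fin 5) ℝ) : Matrix (Fin 5) (Fin 5) ℝ) =
      (mat U).map (Int.cast : ℤ → ℝ) := rfl
  rwa [e] at h

/-- A primitive isotropic vector of `U(1) ⊕ (-2)` is up to sign the square of a primitive vector
of `ℤ²`. -/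
theorem exists_eq_sq_of_mul_eq_sq {a b c : ℤ} (h : a * c = b ^ 2)
    (hp : ∃ y₁ y₂ y₃ : ℤ, y₁ * a + y₂ * b + y₃ * c = 1) :
    ∃ s p q u v : ℤ, a = s * p ^ 2 ∧ b = s * (p * q) ∧ c = s * q ^ 2 ∧ u * p + v * q = 1 := by
  obtain ⟨y₁, y₂, y₃, hy⟩ := hp
  have hac : IsCoprime a c :=
    ⟨y₁ ^ 2 * a + 2 * y₁ * y₂ * b + 2 * y₁ * y₃ * c + y₂ ^ 2 * c, y₃ ^ 2 * c + 2 * y₂ * y₃ * b, by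
      linear_combination (y₁ * a + y₂ * b + y₃ * c + 1) * hy + y₂ ^ 2 * h⟩
  obtain ⟨p, hp⟩ := Int.sq_of_isCoprime hac h
  obtain ⟨q, hq⟩ := Int.sq_of_isCoprime hac.symm ((mul_comm c a).trans h)
  have hpq : IsCoprime p q := by
    have h2 : IsCoprime (p ^ 2) (q ^ 2) := by
      rcases hp with rfl | rfl <;> rcases hq with rfl | rfl <;>
        simpa [IsCoprime.neg_left_iff, IsCoprime.neg_right_iff] using hac
    exact (IsCoprime.pow_iff two_pos two_pos).1 h2
  have key : ∃ s : ℤ, s ^ 2 = 1 ∧ a = s * p ^ 2 ∧ c = s * q ^ 2 := by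
    rcases hp with hp | hp <;> rcases hq with hq | hq
    · exact ⟨1, by norm_num, by rw [hp, one_mul], by rw [hq, one_mul]⟩
    · -- opposite signs: `a c = b²` forces one of `a`, `c` to vanish
      have h0 : p * q = 0 := by
        rw [hp, hq] at h
        nlinarith [sq_nonneg b, sq_nonneg (p * q)]
      rcases mul_eq_zero.1 h0 with h0 | h0
      · exact ⟨-1, by norm_num, by rw [hp, h0]; ring, by rw [hq]; ring⟩
      · exact ⟨1, by norm_num, by rw [hp]; ring, by rw [hq, h0]; ring⟩
    · have h0 : p * q = 0 := by
        rw [hp, hq] at h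
        nlinarith [sq_nonneg b, sq_nonneg (p * q)]
      rcases mul_eq_zero.1 h0 with h0 | h0
      · exact ⟨1, by norm_num, by rw [hp, h0]; ring, by rw [hq]; ring⟩
      · exact ⟨-1, by norm_num, by rw [hp]; ring, by rw [hq, h0]; ring⟩
    · exact ⟨-1, by norm_num, by rw [hp]; ring, by rw [hq]; ring⟩
  obtain ⟨s, hs, ha, hc⟩ := key
  obtain ⟨u, v, huv⟩ := hpq
  have hb : (b - s * (p * q)) * (b + s * (p * q)) = 0 := by
    rw [ha, hc] at h
    linear_combination -h
  rcases mul_eq_zero.1 hb with hb | hb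
  · exact ⟨s, p, q, u, v, ha, by linear_combination hb, hc, huv⟩
  · exact ⟨s, p, -q, u, -v, ha, by linear_combination hb, by rw [hc]; ring,
      by linear_combination huv⟩

/-- The only element of the discriminant kernel of the form `diag(1, s, k, s, 1)` is `1`; the
sign `s = -1` is not in the identity component. -/
theorem eq_one_of_fixes {U : discKernel S₁}
    (h0 : (fun k => mat U k 0) = ![1, 0, 0, 0, 0]) (h4 : (fun k => mat U k 4) = ![0, 0, 0, 0, 1])
    {s : ℤ} (h1 : (fun k => mat U k 1) = ![0, s, 0, 0, 0]) (h23 : mat U 2 3 = 0) : U = 1 := by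
  have a0 := fun k => congrFun h0 k
  have a1 := fun k => congrFun h1 k
  have a4 := fun k => congrFun h4 k
  simp only [Fin.forall_fin_succ, IsEmpty.forall_iff] at a0 a1 a4
  have q := mat_form U
  have q02 := q 0 2
  have q03 := q 0 3
  have q42 := q 4 2
  have q43 := q 4 3
  have q12 := q 1 2
  have q13 := q 1 3
  have q33 := q 3 3
  have q23 := q 2 3
  have hpos := det_positivePairing_mat_pos U
  have hdet : (mat U).det = 1 := U.1.2
  simp at a0 a1 a4
  simp [a0, a1, a4, S₁_eq, h23] at q02 q03 q42 q43 q12 q13 q33 q23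
  obtain ⟨a00, a10, a20, a30, a40⟩ := a0
  obtain ⟨a01, a11, a21, a31, a41⟩ := a1
  obtain ⟨a04, a14, a24, a34, a44⟩ := a4
  have hs0 : s ≠ 0 := by
    rintro rfl
    simp at q13
  have h330 : mat U 3 3 ≠ 0 := right_ne_zero_of_mul_eq_one q13
  have q32 : mat U 3 2 = 0 := q12.resolve_left hs0
  have q13' : mat U 1 3 = 0 := by
    simp only [q03, q43, mul_zero, zero_add] at q33
    exact (mul_eq_zero.1 (show mat U 1 3 * mat U 3 3 = 0 by linarith)).resolve_right h330
  have q12' : mat U 1 2 = 0 := by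
    simp only [q42, q02, q32, zero_mul, zero_add, add_zero] at q23
    exact (mul_eq_zero.1 q23).resolve_right h330
  have hU : mat U = diagonal ![1, s, mat U 2 2, mat U 3 3, 1] := by
    ext i j
    fin_cases i <;> fin_cases j <;> simp [*]
  have h33 : mat U 3 3 = s := by
    rcases Int.isUnit_iff.1 (IsUnit.of_mul_eq_one _ q13) with h | h <;> rw [h] at q13 ⊢ <;> linarith
  rw [hU, Matrix.det_diagonal] at hdet
  simp [Fin.prod_univ_five] at hdet
  have hs : s = 1 := by
    rcases Int.isUnit_iff.1 (IsUnit.of_mul_eq_one _ q13) with h | h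
    · exact h
    · -- for `s = -1` the orientation of the positive definite plane is reversed
      exfalso
      rw [hU, h33, h] at hpos
      simp [positivePairing, Matrix.det_fin_two_of] at hpos
      linarith
  have h22 : mat U 2 2 = 1 := by
    rw [h33, hs] at hdet
    simpa using hdet
  refine mat_injective (hU.trans ?_)
  rw [h33, h22, hs]
  change _ = (1 : Matrix (Fin 5) (Fin 5) ℤ)
  decide

theorem tilde_levi_mulVec (V : SpecialLinearGroup (Fin 2) ℤ) (x : Fin 5 → ℤ) :
    tilde (levi V) *ᵥ x =
      ![x 0, V 0 0 ^ 2 * x 1 + 2 * (V 0 0 * V 0 1) * x 2 + V 0 1 ^ 2 * x 3,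
        V 0 0 * V 1 0 * x 1 + (V 0 0 * V 1 1 + V 0 1 * V 1 0) * x 2 + V 0 1 * V 1 1 * x 3,
        V 1 0 ^ 2 * x 1 + 2 * (V 1 0 * V 1 1) * x 2 + V 1 1 ^ 2 * x 3, x 4] := by
  rw [tilde_levi]
  ext i
  fin_cases i <;> simp [Matrix.mulVec, dotProduct, Fin.sum_univ_five]

theorem col_tildeHom_mul (M : Γ₂) (U : discKernel S₁) (j : Fin 5) :
    (fun k => mat (tildeHom M * U) k j) = tilde M *ᵥ fun k => mat U k j :=
  funext fun _ => mat_tildeHom_mul_apply _ _ _ _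

theorem mem_range_of_mul (M : Γ₂) {U : discKernel S₁} (h : tildeHom M * U ∈ tildeHom.range) :
    U ∈ tildeHom.range :=
  (Subgroup.mul_mem_cancel_left _ (MonoidHom.mem_range.2 ⟨M, rfl⟩)).1 h

/-- A shear of `SL₂(ℤ)` makes `U` diagonal. -/
theorem mem_range_of_fixes_isotropic_flag {U : discKernel S₁}
    (h0 : (fun k => mat U k 0) = ![1, 0, 0, 0, 0]) (h4 : (fun k => mat U k 4) = ![0, 0, 0, 0, 1])
    {s : ℤ} (h1 : (fun k => mat U k 1) = ![0, s, 0, 0, 0]) : U ∈ tildeHom.range := by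
  refine mem_range_of_mul (levi (shearUp (-(s * mat U 2 3)))) ?_
  have hv : (shearUp (-(s * mat U 2 3)) : Matrix (Fin 2) (Fin 2) ℤ) =
    !![1, -(s * mat U 2 3); 0, 1] := rfl
  have q13 := mat_form U 1 3
  have a1 := fun k => congrFun h1 k
  simp only [Fin.forall_fin_succ, IsEmpty.forall_iff] at a1
  simp at a1
  obtain ⟨a01, a11, a21, a31, a41⟩ := a1
  simp [a01, a11, a21, a31, a41, S₁_eq] at q13
  have hone : tildeHom (levi (shearUp (-(s * mat U 2 3)))) * U = 1 := by
    refine eq_one_of_fixes (s := s) ?_ ?_ ?_ ?_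
    · rw [col_tildeHom_mul, h0, tilde_levi_mulVec, hv]
      simp
    · rw [col_tildeHom_mul, h4, tilde_levi_mulVec, hv]
      simp
    · rw [col_tildeHom_mul, h1, tilde_levi_mulVec, hv]
      simp
    · rw [mat_tildeHom_mul_apply, tilde_levi_mulVec, hv]
      simp
      linear_combination -mat U 2 3 * q13
  rw [hone]
  exact one_mem _

/-- The second column of `U` is `s` times the square of a vector `(p, q)`, which can be moved to
`(1, 0)` by `SL₂(ℤ)`. -/
theorem mem_range_of_fixes_hyperbolic_pair {U : discKernel S₁}
    (h0 : (fun k => mat U k 0) = ![1, 0, 0, 0, 0])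
    (h4 : (fun k => mat U k 4) = ![0, 0, 0, 0, 1]) : U ∈ tildeHom.range := by
  have a0 := fun k => congrFun h0 k
  have a4 := fun k => congrFun h4 k
  simp only [Fin.forall_fin_succ, IsEmpty.forall_iff] at a0 a4
  have q01 := mat_form U 0 1
  have q41 := mat_form U 4 1
  have q11 := mat_form U 1 1
  simp at a0 a4
  simp [a0, a4, S₁_eq] at q01 q41 q11
  obtain ⟨y, hy⟩ := exists_dotProduct_col_eq_one U 1
  simp only [dotProduct, Fin.sum_univ_five, q01, q41, mul_zero, zero_add, add_zero] at hy
  simp only [q01, q41, mul_zero, zero_add] at q11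
  obtain ⟨s, p, q, u, v, e1, e2, e3, huv⟩ := exists_eq_sq_of_mul_eq_sq
    (show mat U 1 1 * mat U 3 1 = mat U 2 1 ^ 2 by linarith) ⟨_, _, _, hy⟩
  -- the matrix of `SL₂(ℤ)` that maps `(p, q)` to `(1, 0)`
  let V : SpecialLinearGroup (Fin 2) ℤ := ⟨!![u, v; -q, p], by
    rw [Matrix.det_fin_two_of]
    linear_combination huv⟩
  have hV : (V : Matrix (Fin 2) (Fin 2) ℤ) = !![u, v; -q, p] := rfl
  refine mem_range_of_mul (levi V) ?_
  refine mem_range_of_fixes_isotropic_flag (s := s) ?_ ?_ ?_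
  · rw [col_tildeHom_mul, h0, tilde_levi_mulVec, hV]
    simp
  · rw [col_tildeHom_mul, h4, tilde_levi_mulVec, hV]
    simp
  · rw [col_tildeHom_mul, tilde_levi_mulVec, hV, e1, e2, e3, q01, q41]
    simp
    refine ⟨?_, ?_, ?_⟩
    · linear_combination s * (u * p + v * q + 1) * huv
    · ring
    · ring

/-- After a translation `U` also fixes the last basis vector. -/
theorem mem_range_of_fixes_isotropic {U : discKernel S₁}
    (h0 : (fun k => mat U k 0) = ![1, 0, 0, 0, 0]) : U ∈ tildeHom.range := by
  refine mem_range_of_mul (transUp (-mat U 1 4) (-mat U 2 4) (-mat U 3 4)) ?_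
  have a0 := fun k => congrFun h0 k
  simp only [Fin.forall_fin_succ, IsEmpty.forall_iff] at a0
  have q04 := mat_form U 0 4
  have q44 := mat_form U 4 4
  simp at a0
  simp [a0, S₁_eq] at q04
  simp [q04, S₁_eq] at q44
  refine mem_range_of_fixes_hyperbolic_pair ?_ ?_
  · rw [col_tildeHom_mul, h0, tilde_transUp_mulVec]
    simp
  · rw [col_tildeHom_mul, tilde_transUp_mulVec, q04]
    simp
    linarith

/-- Transitivity on primitive isotropic vectors reduces to matrices that fix the first basis
vector. -/
theorem tildeHom_surjective : Function.Surjective tildeHom := by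
  refine MonoidHom.range_eq_top.1 (eq_top_iff.2 fun U _ => ?_)
  have hU : IsPrimitiveIsotropic fun k => mat U k 0 := by
    refine ⟨?_, exists_dotProduct_col_eq_one U 0⟩
    have h := mat_form U 0 0
    simp [S₁_eq] at h
    linarith
  obtain ⟨M, -, hM⟩ := hU.reducible
  refine mem_range_of_mul M ?_
  exact mem_range_of_fixes_isotropic (by rw [col_tildeHom_mul, hM])

/-! ### Congruences -/

theorem Γ₂.relations_transpose (M : Γ₂) : M.D * M.Aᵀ - M.C * M.Bᵀ = 1 := by
  obtain ⟨i1, i2, i3, i4⟩ := M.inv_blocks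
  have h := (M⁻¹).relations.2.2.2.2
  rw [i1, i2, i3, i4] at h
  simpa using h

/-- The middle column of `M̃ - I` is even. -/
theorem tilde_middle_column (M : Γ₂) :
    (tilde M - 1) 0 2 = 2 * (M.A 1 1 * M.B 0 1 - M.A 0 1 * M.B 1 1) ∧
    (tilde M - 1) 1 2 = 2 * (M.A 0 1 * M.D 1 1 - M.B 0 1 * M.C 1 1) ∧
    (tilde M - 1) 2 2 = 2 * (M.B 0 1 * M.C 0 1 - M.A 0 1 * M.D 0 1) ∧
    (tilde M - 1) 3 2 = 2 * (M.B 1 1 * M.C 0 1 - M.A 1 1 * M.D 0 1) ∧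
    (tilde M - 1) 4 2 = 2 * (M.C 0 1 * M.D 1 1 - M.C 1 1 * M.D 0 1) := by
  have h := fun i j => congrFun (congrFun M.relations_transpose i) j
  have h00 := h 0 0
  have h01 := h 0 1
  have h10 := h 1 0
  simp [Matrix.mul_apply, Fin.sum_univ_two] at h00 h01 h10
  simp only [Matrix.sub_apply, tilde_eq]
  simp
  refine ⟨?_, ?_, ?_, ?_⟩
  · linear_combination -h10
  · linear_combination h00
  · linear_combination h01
  · ring

/-- The converse of `scalar_of_tilde_modEq_one`, with an extra factor `2` in the middle column. -/
theorem dvd_tilde_of_scalar {N : ℕ} {M : Γ₂} {ε : ℤ} (hε : ε ^ 2 ≡ 1 [ZMOD N])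
    (h : ∀ i j, (M : Matrix (Fin 2 ⊕ Fin 2) (Fin 2 ⊕ Fin 2) ℤ) i j
      ≡ (ε • (1 : Matrix (Fin 2 ⊕ Fin 2) (Fin 2 ⊕ Fin 2) ℤ)) i j [ZMOD N]) (i j : Fin 5) :
    (N : ℤ) * (![1, 1, -2, 1, 1] : Fin 5 → ℤ) j ∣ (tilde M - 1) i j := by
  obtain ⟨m0, m1, m2, m3, m4⟩ := tilde_middle_column M
  have e := tilde_eq M
  have two : ∀ w : ℤ, ((w : ℤ) : ZMod N) = 0 → (N : ℤ) * -2 ∣ 2 * w := by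
    intro w hw
    rw [ZMod.intCast_zmod_eq_zero_iff_dvd] at hw
    obtain ⟨c, rfl⟩ := hw
    exact ⟨-c, by ring⟩
  rw [M.eq_fromBlocks] at h
  simp only [← ZMod.intCast_eq_intCast_iff] at h hε
  simp only [Sum.forall, Fin.forall_fin_two, fromBlocks_apply₁₁, fromBlocks_apply₁₂,
    fromBlocks_apply₂₁, fromBlocks_apply₂₂, Matrix.smul_apply, Matrix.one_apply, Sum.inl.injEq,
    Sum.inr.injEq, reduceCtorEq, Fin.isValue, one_ne_zero, zero_ne_one, if_true, if_false,
    smul_eq_mul, mul_one, mul_zero, Int.cast_zero] at h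
  obtain ⟨⟨⟨⟨a00, a01⟩, b00, b01⟩, ⟨a10, a11⟩, b10, b11⟩, ⟨⟨c00, c01⟩, d00, d01⟩, ⟨c10, c11⟩,
    d10, d11⟩ := h
  push_cast at hε
  have hmod : ∀ i j, (((tilde M - 1) i j : ℤ) : ZMod N) = 0 := by
    intro i j
    rw [Matrix.sub_apply, e]
    fin_cases i <;> fin_cases j <;>
      simp [a00, a01, a10, a11, b00, b01, b10, b11, c00, c01, c10, c11, d00, d01, d10, d11] <;>
      linear_combination hε
  have hmid : ∀ i, (N : ℤ) * -2 ∣ (tilde M - 1) i 2 := by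
    intro i
    fin_cases i
    · exact (two _ (by push_cast; rw [b01, b11]; ring)).trans m0.symm.dvd
    · exact (two _ (by push_cast; rw [a01, b01]; ring)).trans m1.symm.dvd
    · exact (two _ (by push_cast; rw [b01, a01]; ring)).trans m2.symm.dvd
    · exact (two _ (by push_cast; rw [c01, d01]; ring)).trans m3.symm.dvd
    · exact (two _ (by push_cast; rw [c01, d01]; ring)).trans m4.symm.dvd
  have hdvd := fun i j => (ZMod.intCast_zmod_eq_zero_iff_dvd _ _).1 (hmod i j)
  fin_cases j
  · simpa using hdvd i 0
  · simpa using hdvd i 1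
  · simpa using hmid i
  · simpa using hdvd i 3
  · simpa using hdvd i 4

theorem mem_principal_iff (N : ℕ) (M : Γ₂) : M ∈ principal N ↔
    ∀ i j, (N : ℤ) * (![1, 1, -2, 1, 1] : Fin 5 → ℤ) j ∣ (tilde M - 1) i j := by
  constructor
  · rintro ⟨ε, hε, h⟩
    exact dvd_tilde_of_scalar hε h
  · intro h
    exact scalar_of_tilde_modEq_one fun i j => (dvd_mul_right _ _).trans (h i j)

theorem ker_tildeHom : tildeHom.ker = pmOne := by
  ext M
  rw [MonoidHom.mem_ker]
  have h1 : tildeHom M = 1 ↔ tilde M = 1 := by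
    rw [← coe_tildeHom]
    exact ⟨fun h => by rw [h]; rfl, fun h => Subtype.ext (Subtype.ext h)⟩
  rw [h1]
  constructor
  · intro h
    obtain ⟨ε, hε, h⟩ := scalar_of_tilde_modEq_one (N := 0) (M := M) (by simp [h])
    have hM : (M : Matrix (Fin 2 ⊕ Fin 2) (Fin 2 ⊕ Fin 2) ℤ) = ε • 1 :=
      Matrix.ext fun i j => Int.modEq_zero_iff.1 (h i j)
    rcases mul_self_eq_one_iff.1 ((sq ε).symm.trans (Int.modEq_zero_iff.1 hε)) with rfl | rfl
    · exact Or.inl (by simpa using hM)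
    · exact Or.inr (by simpa using hM)
  · intro h
    have key : ∃ ε : ℤ, ε ^ 2 ≡ 1 [ZMOD (0 : ℕ)] ∧
        ∀ i j, (M : Matrix (Fin 2 ⊕ Fin 2) (Fin 2 ⊕ Fin 2) ℤ) i j
      ≡ (ε • (1 : Matrix (Fin 2 ⊕ Fin 2) (Fin 2 ⊕ Fin 2) ℤ)) i j [ZMOD (0 : ℕ)] := by
      rcases h with h | h
      · exact ⟨1, by simp, fun i j => by simp [h]⟩
      · exact ⟨-1, by simp, fun i j => by simp [h]⟩
    obtain ⟨ε, hε, h⟩ := key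
    ext i j
    have := dvd_tilde_of_scalar hε h i j
    simpa [sub_eq_zero] using this

theorem smul_S₁_eq (N : ℤ) :
    N • S₁ = antidiagonal fun j => N * (![1, 1, -2, 1, 1] : Fin 5 → ℤ) j := by
  rw [S₁_eq_antidiagonal]
  ext i j
  simp [antidiagonal]

/-- A form and its non-zero multiples have the same orthogonal group. -/
theorem SO₀Int_smul {m : ℕ} {N : ℤ} (hN : N ≠ 0) (T : Matrix (Fin m) (Fin m) ℤ) :
    SO₀Int (N • T) = SO₀Int T := by
  have hN' : (N : ℝ) ≠ 0 := by exact_mod_cast hN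
  have h : ∀ U : SpecialLinearGroup (Fin m) ℝ, U ∈ SO ((N • T).map (Int.cast : ℤ → ℝ)) ↔
      U ∈ SO (T.map (Int.cast : ℤ → ℝ)) := by
    intro U
    have e : (N • T).map (Int.cast : ℤ → ℝ) = (N : ℝ) • T.map (Int.cast : ℤ → ℝ) := by
      ext i j
      exact Int.cast_mul N (T i j)
    rw [e, mem_SO_iff, mem_SO_iff, Matrix.mul_smul, Matrix.smul_mul]
    exact (smul_right_injective _ hN').eq_iff
  ext U
  exact ⟨map_mem_SO₀ continuous_id rfl fun V => (h V).1,
    map_mem_SO₀ continuous_id rfl fun V => (h V).2⟩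

theorem mem_discKernel_smul_iff {N : ℤ} (hN : N ≠ 0) (U : SpecialLinearGroup (Fin 5) ℤ) :
    U ∈ discKernel (N • S₁) ↔ U ∈ SO₀Int S₁ ∧ ∀ i j,
      N * (![1, 1, -2, 1, 1] : Fin 5 → ℤ) j ∣ ((U : Matrix (Fin 5) (Fin 5) ℤ) - 1) i j := by
  rw [← exists_eq_one_add_mul_antidiagonal_iff, ← smul_S₁_eq, ← SO₀Int_smul hN]
  rfl

theorem mem_discKernel_iff (U : SpecialLinearGroup (Fin 5) ℤ) :
    U ∈ discKernel S₁ ↔ U ∈ SO₀Int S₁ ∧ ∀ i j,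
      (![1, 1, -2, 1, 1] : Fin 5 → ℤ) j ∣ ((U : Matrix (Fin 5) (Fin 5) ℤ) - 1) i j := by
  rw [← exists_eq_one_add_mul_antidiagonal_iff, ← S₁_eq_antidiagonal]
  rfl

theorem map_principal_eq {N : ℕ} (hN : 0 < N) :
    (principal N).map ((discKernel S₁).subtype.comp tildeHom) = discKernel ((N : ℤ) • S₁) := by
  have hN' : (N : ℤ) ≠ 0 := by exact_mod_cast hN.ne'
  ext U
  rw [mem_discKernel_smul_iff hN']
  constructor
  · rintro ⟨M, hM, rfl⟩
    refine ⟨(tildeHom M).2.1, ?_⟩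
    have h := (mem_principal_iff N M).1 hM
    rwa [← coe_tildeHom] at h
  · rintro ⟨h1, h2⟩
    have hU : U ∈ discKernel S₁ :=
      (mem_discKernel_iff U).2 ⟨h1, fun i j => (dvd_mul_left _ _).trans (h2 i j)⟩
    obtain ⟨M, hM⟩ := tildeHom_surjective ⟨U, hU⟩
    refine ⟨M, (mem_principal_iff N M).2 ?_, congrArg Subtype.val hM⟩
    rw [← coe_tildeHom, hM]
    exact h2

/-! ### The second congruence subgroup -/

theorem dvd_tilde_of_congCond {n N : ℕ} (hnN : n ∣ N) {M : Γ₂} (h : CongCond n N M)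
    (i j : Fin 5) : (![1, 1, 1, n, N] : Fin 5 → ℤ) i * (![N, n, -2, 1, 1] : Fin 5 → ℤ) j ∣
      (tilde M - 1) i j := by
  obtain ⟨k, hk⟩ := hnN
  have hk : (N : ℤ) = n * k := by exact_mod_cast hk
  obtain ⟨m0, m1, m2, m3, m4⟩ := tilde_middle_column M
  have e := tilde_eq M
  obtain ⟨⟨ε, hε, a00, a11, d00, d11⟩, hA, hD, a10, b11, d01, c00, c01, c10, c11⟩ := h
  rw [Matrix.det_fin_two] at hA hD
  obtain ⟨w, hε⟩ := hε.symm.dvd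
  obtain ⟨x, a00⟩ := a00.symm.dvd
  obtain ⟨y, a11⟩ := a11.symm.dvd
  obtain ⟨z, d00⟩ := d00.symm.dvd
  obtain ⟨t, d11⟩ := d11.symm.dvd
  have hA := hA.symm.dvd
  have hD := hD.symm.dvd
  rw [Int.modEq_zero_iff_dvd] at a10 b11 d01 c00 c01 c10 c11
  obtain ⟨α, a10⟩ := a10
  obtain ⟨β, b11⟩ := b11
  obtain ⟨δ, d01⟩ := d01
  obtain ⟨γ, c00⟩ := c00
  obtain ⟨p, c01⟩ := c01
  obtain ⟨q, c10⟩ := c10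
  obtain ⟨r, c11⟩ := c11
  rw [sub_eq_iff_eq_add'] at a00 a11 d00 d11
  push_cast at c00
  have two : ∀ f v : ℤ, f ∣ v → f * -2 ∣ 2 * v := by
    rintro f _ ⟨c, rfl⟩
    exact ⟨-c, by ring⟩
  fin_cases j
  · fin_cases i <;> simp [e]
    · exact hA
    · exact ⟨M.A 0 1 * q - M.A 0 0 * r, by rw [c10, c11]; ring⟩
    · exact ⟨M.A 0 0 * p - M.A 0 1 * n * γ, by rw [c00, c01]; ring⟩
    · exact ⟨α * p - M.A 1 1 * γ, by rw [c00, c01, a10]; ring⟩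
    · exact ⟨p * q - n * γ * r, by rw [c00, c01, c10, c11]; ring⟩
  · fin_cases i <;> simp [e]
    · exact ⟨α * M.B 0 1 - M.A 0 0 * β, by rw [a10, b11]; ring⟩
    · exact ⟨w + ε * x + ε * t + n * x * t - k * M.B 0 1 * q, by
        rw [a00, d11, c10, hk]; linear_combination hε⟩
    · exact ⟨k * n * γ * M.B 0 1 - M.A 0 0 * δ, by rw [c00, d01, hk]; ring⟩
    · exact ⟨k * n * γ * β - α * δ, by rw [a10, d01, b11, c00, hk]; ring⟩
    · exact ⟨γ * M.D 1 1 - q * δ, by rw [c00, c10, d01]; ring⟩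
  · fin_cases i
    · exact (two 1 _ (one_dvd _)).trans m0.symm.dvd
    · exact (two 1 _ (one_dvd _)).trans m1.symm.dvd
    · exact (two 1 _ (one_dvd _)).trans m2.symm.dvd
    · exact (two n _ ⟨k * β * n * p - M.A 1 1 * δ, by
        rw [b11, c01, d01, hk]; ring⟩).trans m3.symm.dvd
    · exact (two N _ ⟨p * M.D 1 1 - r * M.D 0 1, by rw [c01, c11]; ring⟩).trans m4.symm.dvd
  · fin_cases i <;> simp [e]
    · exact ⟨w + ε * y + ε * z + n * y * z - k * M.B 1 0 * p, by
        rw [a11, d00, c01, hk]; linear_combination hε⟩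
    · exact ⟨r * M.D 0 0 - p * M.D 1 0, by rw [c11, c01]; ring⟩
  · fin_cases i <;> simp [e]
    · exact ⟨β * M.D 0 0 - M.B 1 0 * δ, by rw [b11, d01]; ring⟩
    · exact hD

theorem congCond_of_dvd_tilde {n N : ℕ} (hnN : n ∣ N) {M : Γ₂}
    (h : ∀ i j, (![1, 1, 1, n, N] : Fin 5 → ℤ) i * (![N, n, -2, 1, 1] : Fin 5 → ℤ) j ∣
      (tilde M - 1) i j) : CongCond n N M := by
  have h00 := h 0 0
  have h10 := h 1 0
  have h20 := h 2 0
  have h30 := h 3 0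
  have h11 := h 1 1
  have h21 := h 2 1
  have h33 := h 3 3
  have h34 := h 3 4
  have h44 := h 4 4
  clear h
  simp only [Matrix.sub_apply, tilde_eq] at h00 h10 h20 h30 h11 h21 h33 h34 h44
  simp at h00 h10 h20 h30 h11 h21 h33 h34 h44
  obtain ⟨-, -, r3, -, r5⟩ := M.relations
  have e3 := congrFun (congrFun r3 0) 1
  have e5 := fun i j => congrFun (congrFun r5 i) j
  have e500 := e5 0 0
  simp only [Matrix.mul_apply, Fin.sum_univ_two, Matrix.transpose_apply] at e3
  simp [Matrix.mul_apply, Fin.sum_univ_two] at e500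
  have e501 := e5 0 1
  have e510 := e5 1 0
  have e511 := e5 1 1
  simp [Matrix.mul_apply, Fin.sum_univ_two] at e501 e510 e511
  have hnN' : (n : ℤ) ∣ N := by exact_mod_cast hnN
  have toN : ∀ {x y : ℤ}, (N : ℤ) ∣ x - y → (x : ZMod N) = y := fun h =>
    ((ZMod.intCast_eq_intCast_iff_dvd_sub _ _ _).2 h).symm
  have ofN : ∀ {x : ℤ}, (x : ZMod N) = 0 → (N : ℤ) ∣ x := fun h =>
    (ZMod.intCast_zmod_eq_zero_iff_dvd _ _).1 h
  have ton : ∀ {x : ℤ}, (n : ℤ) ∣ x → (x : ZMod n) = 0 := fun h =>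
    (ZMod.intCast_zmod_eq_zero_iff_dvd _ _).2 h
  have ofn : ∀ {x : ℤ}, (x : ZMod n) = 0 → (n : ℤ) ∣ x := fun h =>
    (ZMod.intCast_zmod_eq_zero_iff_dvd _ _).1 h
  have hC : (N : ℤ) ∣ M.C 0 0 ∧ (N : ℤ) ∣ M.C 0 1 ∧ (N : ℤ) ∣ M.C 1 0 ∧ (N : ℤ) ∣ M.C 1 1 := by
    -- modulo `N`, `A C^♯ = 0` and `det A = 1`
    have g30 := (dvd_mul_left (N : ℤ) n).trans h30
    rw [← ZMod.intCast_zmod_eq_zero_iff_dvd] at h00 h10 h20 g30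
    have e3' := congrArg (Int.cast : ℤ → ZMod N) e3
    push_cast at h00 h10 h20 g30 e3'
    refine ⟨ofN ?_, ofN ?_, ofN ?_, ofN ?_⟩
    · linear_combination -(M.C 0 0 : ZMod N) * h00 - M.A 0 0 * g30 + M.A 1 0 * h20
    · linear_combination -(M.C 0 1 : ZMod N) * h00 - M.A 0 1 * g30 + M.A 1 1 * h20
    · linear_combination -(M.C 1 0 : ZMod N) * h00 - M.A 1 0 * h10 - M.A 0 0 * (e3' - h20)
    · linear_combination -(M.C 1 1 : ZMod N) * h00 - M.A 1 1 * h10 - M.A 0 1 * (e3' - h20)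
  obtain ⟨c00, c01, c10, c11⟩ := hC
  have g00 := ton (hnN'.trans h00)
  have k00 := ton (hnN'.trans c00)
  have k01 := ton (hnN'.trans c01)
  have k10 := ton (hnN'.trans c10)
  have g11 := ton h11
  have g21 := ton h21
  have g33 := ton h33
  have g34 := ton h34
  have f500 := congrArg (Int.cast : ℤ → ZMod n) e500
  have f501 := congrArg (Int.cast : ℤ → ZMod n) e501
  push_cast at g00 g11 g21 g33 g34 f500 f501
  simp only [k00, k01, k10, mul_zero, zero_mul, sub_zero, add_zero] at g11 g21 g33 f500 f501
  -- modulo `n`, the diagonal entries are units and the corner entries vanish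
  have d01 : (M.D 0 1 : ZMod n) = 0 := by
    linear_combination -(M.D 0 1 : ZMod n) * g11 - M.D 1 1 * g21
  have a10 : (M.A 1 0 : ZMod n) = 0 := by
    linear_combination -(M.A 1 0 : ZMod n) * g11 + M.A 0 0 * (f501 - M.A 0 0 * d01)
  rw [a10] at g00 f500
  have b11 : (M.B 1 1 : ZMod n) = 0 := by
    linear_combination -(M.B 1 1 : ZMod n) * g33 + M.A 1 1 * (g34 + M.B 1 0 * d01)
  have hε : (M.A 0 0 : ZMod n) ^ 2 = 1 := by
    linear_combination -(M.A 0 0 : ZMod n) ^ 2 * g33 + (M.A 0 0 * M.D 0 0 : ZMod n) * g00 + f500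
  have a11 : (M.A 1 1 : ZMod n) = M.A 0 0 := by
    linear_combination -(M.A 1 1 : ZMod n) * hε + M.A 0 0 * g00
  have d00 : (M.D 0 0 : ZMod n) = M.A 0 0 := by
    linear_combination -(M.D 0 0 : ZMod n) * hε + M.A 0 0 * f500
  have d11 : (M.D 1 1 : ZMod n) = M.A 0 0 := by
    linear_combination -(M.D 1 1 : ZMod n) * hε + M.A 0 0 * g11
  have c00' : ((N * n : ℕ) : ℤ) ∣ M.C 0 0 := by
    have h1 : (n : ℤ) * N ∣ M.A 1 0 * M.C 0 1 := mul_dvd_mul (ofn a10) c01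
    have h2 : (n : ℤ) ∣ 1 - M.A 0 0 * M.A 1 1 := ofn (by push_cast; linear_combination -g00)
    have h3 := ((mul_dvd_mul h2 c00).sub (h30.mul_left (M.A 0 0))).add (h1.mul_left (M.A 0 0))
    rw [show (1 - M.A 0 0 * M.A 1 1) * M.C 0 0 -
      M.A 0 0 * (M.A 1 0 * M.C 0 1 - M.A 1 1 * M.C 0 0) + M.A 0 0 * (M.A 1 0 * M.C 0 1) =
      M.C 0 0 by ring] at h3
    rwa [Nat.cast_mul, mul_comm]
  rw [CongCond, Matrix.det_fin_two, Matrix.det_fin_two]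
  simp only [Int.modEq_zero_iff_dvd]
  have modn : ∀ {x y : ℤ}, (x : ZMod n) = y → x ≡ y [ZMOD n] := fun h =>
    (ZMod.intCast_eq_intCast_iff _ _ _).1 h
  exact ⟨⟨M.A 0 0, modn (by push_cast; exact hε), modn rfl, modn a11, modn d00, modn d11⟩,
    (Int.modEq_iff_dvd.2 h00).symm, (Int.modEq_iff_dvd.2 h44).symm, ofn a10, ofn b11, ofn d01,
    c00', c01, c10, c11⟩

/-- The congruences that define `congSubgroup` are the divisibility conditions of
`mem_conjKernel_iff`. -/
theorem mem_congSubgroup_iff {n N : ℕ} (hnN : n ∣ N) (M : Γ₂) : M ∈ congSubgroup n N hnN ↔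
    ∀ i j, (![1, 1, 1, n, N] : Fin 5 → ℤ) i * (![N, n, -2, 1, 1] : Fin 5 → ℤ) j ∣
      (tilde M - 1) i j :=
  ⟨dvd_tilde_of_congCond hnN, congCond_of_dvd_tilde hnN⟩

/-! ### Conjugation by a diagonal matrix -/

/-- The matrix `diag(1, 1, 1, n, N)`. -/
def scaling (n N : ℕ) : Fin 5 → ℤ := ![1, 1, 1, n, N]

theorem prod_scaling (n N : ℕ) : ∏ i, scaling n N i = n * N := by
  simp [scaling, Fin.prod_univ_five]

theorem diagonal_scaling_mul_S₁ (n N : ℕ) :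
    diagonal (scaling n N) * S₁ = antidiagonal ![N, n, -2, 1, 1] := by
  rw [S₁_eq]
  ext i j
  rw [Matrix.diagonal_mul]
  fin_cases i <;> fin_cases j <;> simp [antidiagonal, scaling]

theorem formT_eq_mul (N n : ℕ) :
    formT N n = diagonal (scaling n N) * S₁ * diagonal (scaling n N) := by
  rw [S₁_eq, formT_eq]
  ext i j
  rw [Matrix.mul_diagonal, Matrix.diagonal_mul]
  fin_cases i <;> fin_cases j <;> simp [scaling]

/-- Conjugation by `D` with inverse `D'` carries `SO₀(Dᵗ T D)` to `SO₀(T)`. -/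
theorem conj_mem_SO₀ {m : ℕ} {T T' D D' : Matrix (Fin m) (Fin m) ℝ} (h : D * D' = 1)
    (hT : Dᵀ * T' * D = T) {U V : SpecialLinearGroup (Fin m) ℝ} (hU : U ∈ SO₀ T)
    (hV : (V : Matrix (Fin m) (Fin m) ℝ) = D * (U : Matrix (Fin m) (Fin m) ℝ) * D') :
    V ∈ SO₀ T' := by
  have hdet : ∀ W : SpecialLinearGroup (Fin m) ℝ,
      (D * (W : Matrix (Fin m) (Fin m) ℝ) * D').det = 1 := by
    intro W
    rw [Matrix.det_mul, Matrix.det_mul, W.2, mul_one, ← Matrix.det_mul, h, Matrix.det_one]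
  let f : SpecialLinearGroup (Fin m) ℝ → SpecialLinearGroup (Fin m) ℝ := fun W =>
    ⟨D * (W : Matrix (Fin m) (Fin m) ℝ) * D', hdet W⟩
  have hf : Continuous f :=
    Continuous.subtype_mk ((continuous_const.matrix_mul continuous_subtype_val).matrix_mul
      continuous_const) _
  have hVf : V = f U := Subtype.ext hV
  rw [hVf]
  refine map_mem_SO₀ hf ?_ ?_ hU
  · refine Subtype.ext ?_
    change D * 1 * D' = 1
    rw [Matrix.mul_one, h]
  · intro W hW
    rw [mem_SO_iff] at hW ⊢
    change (D * (W : Matrix (Fin m) (Fin m) ℝ) * D')ᵀ * T' *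
      (D * (W : Matrix (Fin m) (Fin m) ℝ) * D') = T'
    have h' : D'ᵀ * Dᵀ = 1 := by rw [← Matrix.transpose_mul, h, Matrix.transpose_one]
    calc (D * (W : Matrix (Fin m) (Fin m) ℝ) * D')ᵀ * T' *
          (D * (W : Matrix (Fin m) (Fin m) ℝ) * D')
        = D'ᵀ * ((W : Matrix (Fin m) (Fin m) ℝ)ᵀ * (Dᵀ * T' * D) *
          (W : Matrix (Fin m) (Fin m) ℝ)) * D' := by
            simp only [Matrix.transpose_mul, Matrix.mul_assoc]
      _ = D'ᵀ * (Dᵀ * T' * D) * D' := by rw [hT, hW]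
      _ = (D'ᵀ * Dᵀ) * T' * (D * D') := by simp only [Matrix.mul_assoc]
      _ = T' := by rw [h, h', Matrix.one_mul, Matrix.mul_one]

theorem scaling_ne_zero {n N : ℕ} (hn : 0 < n) (hN : 0 < N) (i : Fin 5) : scaling n N i ≠ 0 := by
  fin_cases i <;> simp [scaling, hn.ne', hN.ne']

theorem det_diagonal_scaling_ne_zero {n N : ℕ} (hn : 0 < n) (hN : 0 < N) :
    (diagonal (scaling n N)).det ≠ 0 := by
  rw [Matrix.det_diagonal, prod_scaling]
  positivity

/-- Conjugate integral matrices lie in the respective identity components simultaneously. -/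
theorem mem_SO₀Int_iff_of_conj {n N : ℕ} (hn : 0 < n) (hN : 0 < N)
    {U V : SpecialLinearGroup (Fin 5) ℤ}
    (h : diagonal (scaling n N) * (U : Matrix (Fin 5) (Fin 5) ℤ) =
      (V : Matrix (Fin 5) (Fin 5) ℤ) * diagonal (scaling n N)) :
    U ∈ SO₀Int (formT N n) ↔ V ∈ SO₀Int S₁ := by
  let D : Matrix (Fin 5) (Fin 5) ℝ := diagonal fun i => (scaling n N i : ℝ)
  let D' : Matrix (Fin 5) (Fin 5) ℝ := diagonal fun i => (scaling n N i : ℝ)⁻¹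
  have hne : ∀ i, (scaling n N i : ℝ) ≠ 0 := fun i => by
    exact_mod_cast scaling_ne_zero hn hN i
  have h1 : D * D' = 1 := by
    simp only [D, D', Matrix.diagonal_mul_diagonal, mul_inv_cancel₀ (hne _)]
    exact Matrix.diagonal_one
  have h2 : D' * D = 1 := mul_eq_one_comm.1 h1
  have hD : (diagonal (scaling n N)).map (Int.castRingHom ℝ) = D := by
    rw [Matrix.diagonal_map (map_zero _)]
    rfl
  have hT : Dᵀ * S₁.map (Int.castRingHom ℝ) * D = (formT N n).map (Int.castRingHom ℝ) := by
    rw [formT_eq_mul, Matrix.map_mul, Matrix.map_mul, hD]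
    congr 2
    exact Matrix.diagonal_transpose _
  have hT' : D'ᵀ * (formT N n).map (Int.castRingHom ℝ) * D' = S₁.map (Int.castRingHom ℝ) := by
    have h3 : D'ᵀ * Dᵀ = 1 := by rw [← Matrix.transpose_mul, h1, Matrix.transpose_one]
    rw [← hT]
    calc D'ᵀ * (Dᵀ * S₁.map (Int.castRingHom ℝ) * D) * D'
        = (D'ᵀ * Dᵀ) * S₁.map (Int.castRingHom ℝ) * (D * D') := by simp only [Matrix.mul_assoc]
      _ = _ := by rw [h1, h3, Matrix.one_mul, Matrix.mul_one]
  have hc := congrArg (fun A => A.map (Int.castRingHom ℝ)) h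
  simp only [Matrix.map_mul, hD] at hc
  constructor
  · intro hU
    refine conj_mem_SO₀ h1 hT hU ?_
    change (V : Matrix (Fin 5) (Fin 5) ℤ).map (Int.castRingHom ℝ) =
      D * (U : Matrix (Fin 5) (Fin 5) ℤ).map (Int.castRingHom ℝ) * D'
    rw [hc, Matrix.mul_assoc, h1, Matrix.mul_one]
  · intro hV
    refine conj_mem_SO₀ h2 hT' hV ?_
    change (U : Matrix (Fin 5) (Fin 5) ℤ).map (Int.castRingHom ℝ) =
      D' * (V : Matrix (Fin 5) (Fin 5) ℤ).map (Int.castRingHom ℝ) * D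
    rw [Matrix.mul_assoc, ← hc, ← Matrix.mul_assoc, h2, Matrix.one_mul]

theorem mapGL_eq_conj_iff {n N : ℕ} (hn : 0 < n) (hN : 0 < N)
    {U V : SpecialLinearGroup (Fin 5) ℤ} :
    MulAut.conj (matF n N hn hN) (SpecialLinearGroup.mapGL ℚ U) = SpecialLinearGroup.mapGL ℚ V ↔
      diagonal (scaling n N) * (U : Matrix (Fin 5) (Fin 5) ℤ) =
        (V : Matrix (Fin 5) (Fin 5) ℤ) * diagonal (scaling n N) := by
  have hF : ((matF n N hn hN : GL (Fin 5) ℚ) : Matrix (Fin 5) (Fin 5) ℚ) =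
      (diagonal (scaling n N)).map (Int.castRingHom ℚ) := by
    rw [Matrix.diagonal_map (map_zero _)]
    change diagonal _ = _
    congr 1
    ext i
    fin_cases i <;> simp [scaling]
  rw [MulAut.conj_apply, mul_inv_eq_iff_eq_mul, ← Units.val_inj, Units.val_mul, Units.val_mul, hF]
  change (diagonal (scaling n N)).map (Int.castRingHom ℚ) *
    (U : Matrix (Fin 5) (Fin 5) ℤ).map (Int.castRingHom ℚ) =
    (V : Matrix (Fin 5) (Fin 5) ℤ).map (Int.castRingHom ℚ) *
      (diagonal (scaling n N)).map (Int.castRingHom ℚ) ↔ _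
  rw [← Matrix.map_mul, ← Matrix.map_mul]
  exact (Matrix.map_injective (RingHom.injective_int _)).eq_iff

theorem diagonal_scaling_mul_one_add (n N : ℕ) (X : Matrix (Fin 5) (Fin 5) ℤ) :
    diagonal (scaling n N) * (1 + X * formT N n) =
      (1 + diagonal (scaling n N) * X * antidiagonal ![N, n, -2, 1, 1]) *
        diagonal (scaling n N) := by
  rw [← diagonal_scaling_mul_S₁, formT_eq_mul]
  noncomm_ring

/-- The group `F 𝒟(U(N) ⊕ U(n) ⊕ (-2); ℤ) F⁻¹` consists of integral matrices, and it is described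
inside `SO₀(S₁; ℤ)` by divisibility conditions on the entries. -/
theorem mem_conjKernel_iff {n N : ℕ} (hn : 0 < n) (hN : 0 < N) (g : GL (Fin 5) ℚ) :
    g ∈ conjKernel n N hn hN ↔ ∃ V ∈ SO₀Int S₁,
      (∀ i j, (![1, 1, 1, n, N] : Fin 5 → ℤ) i * (![N, n, -2, 1, 1] : Fin 5 → ℤ) j ∣
        ((V : Matrix (Fin 5) (Fin 5) ℤ) - 1) i j) ∧ SpecialLinearGroup.mapGL ℚ V = g := by
  have hne := det_diagonal_scaling_ne_zero hn hN
  constructor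
  · rintro ⟨_, ⟨U, ⟨hU, X, hX⟩, rfl⟩, rfl⟩
    have hc := diagonal_scaling_mul_one_add n N X
    rw [← hX] at hc
    have hdet : (1 + diagonal (scaling n N) * X * antidiagonal ![N, n, -2, 1, 1]).det = 1 := by
      have h := congrArg Matrix.det hc
      rw [Matrix.det_mul, Matrix.det_mul, U.2, mul_one] at h
      exact (mul_right_cancel₀ hne ((one_mul _).trans h)).symm
    refine ⟨⟨_, hdet⟩, (mem_SO₀Int_iff_of_conj hn hN hc).1 hU, ?_,
      ((mapGL_eq_conj_iff hn hN).2 hc).symm⟩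
    refine (exists_eq_diagonal_mul_mul_antidiagonal_iff _ _ _).1 ⟨X, ?_⟩
    exact add_sub_cancel_left _ _
  · rintro ⟨V, hV, h, rfl⟩
    obtain ⟨X, hX⟩ := (exists_eq_diagonal_mul_mul_antidiagonal_iff _ _ _).2 h
    have hc := diagonal_scaling_mul_one_add n N X
    rw [sub_eq_iff_eq_add'] at hX
    rw [scaling, ← hX] at hc
    have hdet : (1 + X * formT N n).det = 1 := by
      have h := congrArg Matrix.det hc
      rw [Matrix.det_mul, Matrix.det_mul, V.2, one_mul] at h
      exact mul_left_cancel₀ hne (h.trans (mul_one _).symm)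
    let U : SpecialLinearGroup (Fin 5) ℤ := ⟨_, hdet⟩
    refine ⟨_, ⟨U, ⟨(mem_SO₀Int_iff_of_conj hn hN (U := U) hc).2 hV, X, rfl⟩, rfl⟩, ?_⟩
    exact (mapGL_eq_conj_iff hn hN (U := U)).2 hc

theorem mem_discKernel_of_dvd {n N : ℕ} {V : SpecialLinearGroup (Fin 5) ℤ} (hV : V ∈ SO₀Int S₁)
    (h : ∀ i j, (![1, 1, 1, n, N] : Fin 5 → ℤ) i * (![N, n, -2, 1, 1] : Fin 5 → ℤ) j ∣
      ((V : Matrix (Fin 5) (Fin 5) ℤ) - 1) i j) : V ∈ discKernel S₁ := by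
  refine (mem_discKernel_iff V).2 ⟨hV, fun i j => Dvd.dvd.trans ?_ (h i j)⟩
  refine Dvd.dvd.mul_left ?_ _
  fin_cases j <;> simp

theorem map_congSubgroup_eq {n N : ℕ} (hn : 0 < n) (hN : 0 < N) (hnN : n ∣ N) :
    ((congSubgroup n N hnN).map ((discKernel S₁).subtype.comp tildeHom)).map
      (SpecialLinearGroup.mapGL ℚ) = conjKernel n N hn hN := by
  ext g
  rw [mem_conjKernel_iff]
  constructor
  · rintro ⟨_, ⟨M, hM, rfl⟩, rfl⟩
    refine ⟨_, (tildeHom M).2.1, ?_, rfl⟩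
    have h := (mem_congSubgroup_iff hnN M).1 hM
    rwa [← coe_tildeHom] at h
  · rintro ⟨V, hV, h, rfl⟩
    obtain ⟨M, hM⟩ := tildeHom_surjective ⟨V, mem_discKernel_of_dvd hV h⟩
    refine ⟨V, ⟨M, (mem_congSubgroup_iff hnN M).2 ?_, congrArg Subtype.val hM⟩, rfl⟩
    rw [← coe_tildeHom, hM]
    exact h

theorem conjKernel_le {n N : ℕ} (hn : 0 < n) (hN : 0 < N) :
    conjKernel n N hn hN ≤ (discKernel S₁).map (SpecialLinearGroup.mapGL ℚ) := by
  intro g hg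
  obtain ⟨V, hV, h, rfl⟩ := (mem_conjKernel_iff hn hN g).1 hg
  exact ⟨V, mem_discKernel_of_dvd hV h, rfl⟩

/-- The isomorphism `±M ↦ M̃`. -/
noncomputable def tildeEquiv : Γ₂ ⧸ pmOne ≃* discKernel S₁ :=
  (QuotientGroup.quotientMulEquivOfEq ker_tildeHom.symm).trans
    (QuotientGroup.quotientKerEquivOfSurjective tildeHom tildeHom_surjective)

theorem tildeEquiv_comp_mk : tildeEquiv.toMonoidHom.comp (QuotientGroup.mk' pmOne) = tildeHom :=
  rfl

end SiegelOrth

open SiegelOrth in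
theorem theorem1 :
    ∃ e : Γ₂ ⧸ pmOne ≃* discKernel S₁,
      (∀ M : Γ₂, ((e (QuotientGroup.mk' pmOne M) : SpecialLinearGroup (Fin 5) ℤ) :
        Matrix (Fin 5) (Fin 5) ℤ) = tilde M) ∧
      (∀ N : ℕ, 0 < N →
        (((principal N).map (QuotientGroup.mk' pmOne)).map e.toMonoidHom).map
          (discKernel S₁).subtype = discKernel ((N : ℤ) • S₁)) ∧
      (∀ (n N : ℕ) (hn : 0 < n) (hN : 0 < N) (hnN : n ∣ N),
        conjKernel n N hn hN ≤ (discKernel S₁).map (SpecialLinearGroup.mapGL ℚ) ∧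
        ((((congSubgroup n N hnN).map (QuotientGroup.mk' pmOne)).map e.toMonoidHom).map
          (discKernel S₁).subtype).map (SpecialLinearGroup.mapGL ℚ) = conjKernel n N hn hN) := by
  refine ⟨tildeEquiv, coe_tildeHom, fun N hN => ?_, fun n N hn hN hnN => ⟨conjKernel_le hn hN, ?_⟩⟩
  · rw [Subgroup.map_map, Subgroup.map_map, MonoidHom.comp_assoc, tildeEquiv_comp_mk,
      map_principal_eq hN]
  · rw [Subgroup.map_map (congSubgroup n N hnN), Subgroup.map_map (congSubgroup n N hnN),
      tildeEquiv_comp_mk, map_congSubgroup_eq hn hN]
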